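/- **Conventions.** Let $n\ge 2$, $\kappa\mid 2n$. *Perfect one-factorizations.* A one-factorization of a graph is a partition of its edge set into one-factors (spanning subgraphs in which every vertex has degree one); it is perfect (a P1F) if the union of any two distinct one-factors is a Hamiltonian cycle. Two one-factorizations are isomorphic if a bijection of the vertices carries the one-factors of the first to those of the second. For odd $p$, $GA_{2p}$ is the one-factorization of $K_{2p}$ on the vertex set $Z_{2p}$ with the factors $\{\{a,b\}: a\ne b,\ a+b=2j\}\cup\{\{j,j+p\}\}$ for $j\in Z_{2p}$ (there are $p$ of them) and $\{\{a,a+i\}: a \text{ even}\}$ for odd $i\neq p$ (there are $p-1$ of them). *Even multi-starters.* An even $\kappa$-starter in $(Z_{2n},+)$ is a family $S^\kappa=\{S_0,\dots,S_{\kappa-1}\}$, where $S_i$ is a set of $n-1$ disjoint pairs of elements of $Z_{2n}\setminus\{i\}$, such that every integer from $1$ to $n-1$ occurs exactly $\kappa$ times as a difference (mod $2n$) of a pair. Let $r_i$ be the element of $Z_{2n}\setminus\{i\}$ that does not occur in $S_i$. If $i\mapsto r_i \bmod \kappa$ is a permutation of $\{0,\dots,\kappa-1\}$, the twin of $S^\kappa$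 is $\{S'_0,\dots,S'_{\kappa-1}\}$ with $S'_{r_i\bmod\kappa}=S_i-\kappa\lfloor r_i/\kappa\rfloor$. Put $\widetilde S_i=S_i\cup\{\{i,\infty_1\},\{r_i,\infty_2\}\}$ and let translations fix $\infty_1,\infty_2$. The $\kappa$-quasi-bipyramidal family induced by $S^\kappa$ is $\mathbb F^\kappa=\{\kappa\tau+\widetilde S_i:\ 0\le i<\kappa,\ 0\le\tau<2n/\kappa\}$, on the $2n$-regular graph with vertex set $Z_{2n}\cup\{\infty_1,\infty_2\}$ whose only non-edges are $\{\infty_1,\infty_2\}$ and the $\{i,i+n\}$. Its completion is $\mathbb F^\kappa\cup\{L\}$, where $L=\{\{\infty_1,\infty_2\}\}\cup\{\{i,i+n\}: i\in Z_{2n}\}$. *Quasi-C-Codes.* A $\kappa$-quasi-C-Code of length $2n$ is a binary code with a parity-check matrix $(H_0\ H_1\cdots H_{2n-1})$, each $H_k$ of size $2n\times n$, such that: the last column of $H_k$ is the $k$-th unit vector; $H_{i+\kappa t}=E^{\kappa t}H_i$ for $0\le i<\kappa$, $0\le t<2n/\kappa$, where $E$ is the $2n\times 2n$ cyclic shift matrix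 (its $j$-th column is the unit vector with index $j+1 \bmod 2n$); every row has weight $2n-1$; and $(H_m\ H_k)$ is nonsingular for all $m\neq k$. Its columns are given by sets of pairs $C_0,\dots,C_{2n-1}$ if, for each $k$, the first $n-1$ columns of $H_k$ are, up to order, the indicator vectors of the $n-1$ pairs in $C_k$. The columns constructed from an even $\kappa$-starter $S^\kappa$ are $C_i=S_{i\bmod\kappa}+\kappa\lfloor i/\kappa\rfloor$, $0\le i\le 2n-1$. **Statement.** Let $p$ be an odd prime, $g$ a generator of $Z_p^*$, and $\log_g$ the discrete logarithm to base $g$. Let $$C_0^A=\{\{\log_g x,\log_g y\}: x,y\in Z_p^*\setminus\{1,2^{-1}\},\ x+y=1\},$$ a set of pairs in $Z_{p-1}$, and let $r$ be the non-zero element of $Z_{p-1}$ that does not occur in $C_0^A$. In $Z_{2(p-1)}$ put $$S_0=\{\{2\log_g x,\,2\log_g y+1\}: x\in Z_p^*\setminus\{1\},\ y\in Z_p^*\setminus\{p-1\},\ x-y=1\},$$ $$S_1=\{\{2x+1,2y+1\}:\{x,y\}\in C_0^A\}\cup\{\{2x,2y\}:\{x,y\}\in C_0^A\}\cup\{\{2r,2r+1\}\},$$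 $$S'_0=S_1,\qquad S'_1=\{\{2\log_g x+1,\,2\log_g y\}: x\in Z_p^*\setminus\{1\},\ y\in Z_p^*\setminus\{p-1\},\ x-y=1\}.$$ Then, with $n=p-1$ and $\kappa=2$: 1. $S^2=\{S_0,S_1\}$ and $\{S'_0,S'_1\}$ are even $2$-starters in $(Z_{2(p-1)},+)$, and $\{S'_0,S'_1\}$ is the twin of $S^2$. 2. Each of the two induces a $2$-quasi-bipyramidal P1F of the $2(p-1)$-regular graph on the $2p$ vertices above, and the two induced P1Fs are the same up to interchanging the names $\infty_1$ and $\infty_2$. 3. The completion of each is a P1F of $K_{2p}$ isomorphic to $GA_{2p}$. 4. The columns constructed from $S^2$, and those constructed from its twin, are the columns of $2$-quasi-C-Codes of length $2(p-1)$, and the two systems of columns are different. So one obtains two infinite families of $2$-quasi-C-Codes of length $2(p-1)$, indexed by the odd primes $p$ (and the generators $g$). -/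

import Mathlib

/-! ### One-factorizations -/

/-- A one-factor on the vertex set `V`: a set of edges (no loops) such that every vertex lies on
exactly one of them. -/
def IsOneFactor {V : Type*} (F : Set (Sym2 V)) : Prop :=
  (∀ e ∈ F, ¬ e.IsDiag) ∧ ∀ v : V, ∃! e : Sym2 V, e ∈ F ∧ v ∈ e

/-- A one-factorization of the graph `G`: a partition of its edge set into one-factors. -/
def IsOneFactorization {V : Type*} (G : SimpleGraph V) (FF : Set (Set (Sym2 V))) : Prop :=
  (∀ F ∈ FF, IsOneFactor F) ∧ (∀ F ∈ FF, F ⊆ G.edgeSet) ∧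
    ∀ e ∈ G.edgeSet, ∃! F : Set (Sym2 V), F ∈ FF ∧ e ∈ F

/-- The edge set `E` is (the edge set of) a Hamiltonian cycle through all the vertices of `V`. -/
def IsHamiltonianCycleEdgeSet {V : Type*} [DecidableEq V] (E : Set (Sym2 V)) : Prop :=
  ∃ (v : V) (w : (SimpleGraph.fromEdgeSet E).Walk v v),
    w.IsHamiltonianCycle ∧ {e | e ∈ w.edges} = E

/-- A perfect one-factorization (P1F) of `G`: the union of any two distinct one-factors is a
Hamiltonian cycle. -/
def IsPerfectOneFactorization {V : Type*} [DecidableEq V] (G : SimpleGraph V)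
    (FF : Set (Set (Sym2 V))) : Prop :=
  IsOneFactorization G FF ∧
    ∀ F ∈ FF, ∀ F' ∈ FF, F ≠ F' → IsHamiltonianCycleEdgeSet (F ∪ F')

/-- The family of edge sets obtained from `FF` by renaming the vertices along `φ`. -/
def relabel {V W : Type*} (φ : V ≃ W) (FF : Set (Set (Sym2 V))) : Set (Set (Sym2 W)) :=
  (fun F => Sym2.map φ '' F) '' FF

/-- Isomorphism of one-factorizations: a bijection of the vertices that carries the one-factors
of the first to the one-factors of the second. -/
def OneFactorizationIso {V W : Type*} (FF : Set (Set (Sym2 V))) (GG : Set (Set (Sym2 W))) : Prop :=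
  ∃ φ : V ≃ W, relabel φ FF = GG

/-- The one-factorization `GA_{2p}` of `K_{2p}` (`p` odd) on the vertex set `Z_{2p}`. For every even
element `2j` it has the factor of all `{a, b}`, `a ≠ b`, with `a + b = 2j`, together with
`{j, j + p}`; for every odd `i ≠ p` it has the factor of all `{a, a + i}` with `a` even. -/
def GA (p : ℕ) : Set (Set (Sym2 (ZMod (2 * p)))) :=
  {F | ∃ j : ZMod (2 * p),
      F = {e | ∃ a b, a ≠ b ∧ a + b = 2 * j ∧ e = s(a, b)} ∪ {s(j, j + (p : ZMod (2 * p)))}} ∪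
  {F | ∃ i : ZMod (2 * p), ¬ Even i ∧ i ≠ (p : ZMod (2 * p)) ∧
      F = {e | ∃ a, Even a ∧ e = s(a, a + i)}}

/-! ### Even multi-starters in `Z_{2n}` -/

/-- The `2n + 2` vertices: the elements of `Z_{2n}` and two infinity elements. -/
abbrev PyrVertex (n : ℕ) : Type := ZMod (2 * n) ⊕ Fin 2

/-- The infinity element `∞₁`. -/
def infOne (n : ℕ) : PyrVertex n := Sum.inr 0

/-- The infinity element `∞₂`. -/
def infTwo (n : ℕ) : PyrVertex n := Sum.inr 1

/-- Interchange of `∞₁` and `∞₂`; the elements of `Z_{2n}` stay fixed. -/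
def swapInf (n : ℕ) : PyrVertex n ≃ PyrVertex n :=
  Equiv.sumCongr (Equiv.refl _) (Equiv.swap 0 1)

/-- The one-factor `{∞₁, ∞₂}`, `{i, i + n}` (`i ∈ Z_{2n}`). -/
def lastFactor (n : ℕ) : Set (Sym2 (PyrVertex n)) :=
  {s(infOne n, infTwo n)} ∪
    {e | ∃ i : ZMod (2 * n), e = s(Sum.inl i, Sum.inl (i + (n : ZMod (2 * n))))}

/-- The `2n`-regular graph on the `2n + 2` vertices: all edges except `{∞₁, ∞₂}` and the
`{i, i + n}`. -/
def pyrGraph (n : ℕ) : SimpleGraph (PyrVertex n) :=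
  (⊤ : SimpleGraph (PyrVertex n)).deleteEdges (lastFactor n)

/-- The pair `e` has `d` as a difference. -/
def HasDifference {N : ℕ} (d : ZMod N) (e : Sym2 (ZMod N)) : Prop :=
  ∃ x y : ZMod N, e = s(x, y) ∧ x - y = d

/-- `r` is a non-`i` element that occurs in no pair of `S_i`. -/
def IsMissing {n κ : ℕ} (S : Fin κ → Set (Sym2 (ZMod (2 * n)))) (i : Fin κ)
    (r : ZMod (2 * n)) : Prop :=
  r ≠ ((i : ℕ) : ZMod (2 * n)) ∧ ∀ e ∈ S i, r ∉ e

/-- `S = {S_0, …, S_{κ-1}}` is an even `κ`-starter in `(Z_{2n}, +)`: each `S_i` consists of `n - 1`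
disjoint pairs of non-`i` elements, and every integer from `1` to `n - 1` occurs exactly `κ` times
as a difference of a pair. -/
structure IsEvenMultiStarter (n κ : ℕ) (S : Fin κ → Set (Sym2 (ZMod (2 * n)))) : Prop where
  dvd : κ ∣ 2 * n
  card : ∀ i, (S i).ncard = n - 1
  pairs : ∀ i, ∀ e ∈ S i, ¬ e.IsDiag ∧ ((i : ℕ) : ZMod (2 * n)) ∉ e
  disjoint : ∀ i, ∀ e ∈ S i, ∀ f ∈ S i, ∀ x, x ∈ e → x ∈ f → e = f
  differences : ∀ d : ℕ, 1 ≤ d → d ≤ n - 1 →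
    {q : Fin κ × Sym2 (ZMod (2 * n)) |
      q.2 ∈ S q.1 ∧ HasDifference (d : ZMod (2 * n)) q.2}.ncard = κ

/-- The set of pairs `{x + c, y + c}` with `{x, y} ∈ A`. -/
def translatePairs {N : ℕ} (c : ZMod N) (A : Set (Sym2 (ZMod N))) : Set (Sym2 (ZMod N)) :=
  Sym2.map (fun x => c + x) '' A

/-- `T` is the twin of `S`: `T_{r_i mod κ} = S_i - κ⌊r_i/κ⌋`, where `r_i` is the non-`i` element
missing from `S_i`, and every index is of the form `r_i mod κ`. -/
def IsTwinStarter (n κ : ℕ) [NeZero κ] (S T : Fin κ → Set (Sym2 (ZMod (2 * n)))) : Prop :=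
  (∀ i r, IsMissing S i r →
    T (Fin.ofNat κ r.val) = translatePairs (-((κ * (r.val / κ) : ℕ) : ZMod (2 * n))) (S i)) ∧
  ∀ j : Fin κ, ∃ i r, IsMissing S i r ∧ Fin.ofNat κ r.val = j

/-- The expanded set `S_i ∪ {{i, ∞₁}, {r_i, ∞₂}}`. -/
def expandedStarter {n κ : ℕ} (S : Fin κ → Set (Sym2 (ZMod (2 * n)))) (i : Fin κ) :
    Set (Sym2 (PyrVertex n)) :=
  Sym2.map Sum.inl '' S i ∪ {s(Sum.inl ((i : ℕ) : ZMod (2 * n)), infOne n)} ∪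
    {e | ∃ r, IsMissing S i r ∧ e = s(Sum.inl r, infTwo n)}

/-- Translation by `c` on the vertices, with `c + ∞ = ∞`. -/
def translateVertex {n : ℕ} (c : ZMod (2 * n)) : PyrVertex n → PyrVertex n :=
  Sum.map (fun x => c + x) id

/-- The `κ`-quasi-bipyramidal family `F^κ` induced by `S`: all translates of the expanded sets by
`κ τ` with `0 ≤ τ < 2n / κ`. -/
def inducedFactorization {n κ : ℕ} (S : Fin κ → Set (Sym2 (ZMod (2 * n)))) :
    Set (Set (Sym2 (PyrVertex n))) :=
  {F | ∃ (i : Fin κ) (τ : ℕ), τ < 2 * n / κ ∧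
    F = Sym2.map (translateVertex ((κ * τ : ℕ) : ZMod (2 * n))) '' expandedStarter S i}

/-- The induced family completed by the factor `{∞₁, ∞₂}`, `{i, i + n}`, which lives on the
complete graph `K_{2n+2}`. -/
def completedFactorization {n κ : ℕ} (S : Fin κ → Set (Sym2 (ZMod (2 * n)))) :
    Set (Set (Sym2 (PyrVertex n))) :=
  insert (lastFactor n) (inducedFactorization S)

/-! ### Quasi-C-Codes -/

/-- The elemental cyclic matrix `E`: its column `j` is the unit vector `j + 1` (cyclically). -/
def elementalCyclic (N : ℕ) : Matrix (ZMod N) (ZMod N) (ZMod 2) :=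
  Matrix.of fun i j => if i = j + 1 then 1 else 0

/-- `(H_0 H_1 ⋯ H_{2n-1})`, with binary blocks `H_k` of size `2n × n`, is a parity-check matrix of
a `κ`-quasi-C-Code of length `2n` (`κ = 1`: of a C-Code). The last column of each block
corresponds to the parity bit, the other columns to the information bits. -/
structure IsQuasiCCodeMatrix (n κ : ℕ) [NeZero n]
    (H : ZMod (2 * n) → Matrix (ZMod (2 * n)) (Fin n) (ZMod 2)) : Prop where
  two_le : 2 ≤ n
  dvd : κ ∣ 2 * n
  last_column : ∀ (k : ZMod (2 * n)) (j : Fin n), (j : ℕ) + 1 = n →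
    ∀ i, H k i j = if i = k then 1 else 0
  cyclic : ∀ i : ℕ, i < κ → ∀ t : ℕ, t < 2 * n / κ →
    H ((i + κ * t : ℕ) : ZMod (2 * n)) =
      elementalCyclic (2 * n) ^ (κ * t) * H ((i : ℕ) : ZMod (2 * n))
  row_weight : ∀ i : ZMod (2 * n),
    {q : ZMod (2 * n) × Fin n | H q.1 i q.2 = 1}.ncard = 2 * n - 1
  nonsingular : ∀ m k : ZMod (2 * n), m ≠ k →
    Function.Bijective fun v : Fin n ⊕ Fin n → ZMod 2 =>
      (Matrix.fromCols (H m) (H k)).mulVec v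

/-- The edge sets `C_0, …, C_{2n-1}` are the graph description of the columns of a code with
parity-check matrix `H`: the information bits of column `k` correspond bijectively to the edges in
`C_k`, and the bit of the edge `{x, y}` contributes exactly to the parity bits `x` and `y`. -/
def DescribesCode {n : ℕ} (C : ZMod (2 * n) → Set (Sym2 (ZMod (2 * n))))
    (H : ZMod (2 * n) → Matrix (ZMod (2 * n)) (Fin n) (ZMod 2)) : Prop :=
  ∀ k, ∃ e : Fin n → Sym2 (ZMod (2 * n)),
    Set.BijOn e {j : Fin n | (j : ℕ) + 1 < n} (C k) ∧
    (∀ f ∈ C k, ¬ f.IsDiag) ∧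
    ∀ j : Fin n, (j : ℕ) + 1 < n → ∀ i, H k i j = if i ∈ e j then 1 else 0

/-- `C_0, …, C_{2n-1}` are the columns of a `κ`-quasi-C-Code of length `2n`. -/
def IsQuasiCCode (n κ : ℕ) [NeZero n] (C : ZMod (2 * n) → Set (Sym2 (ZMod (2 * n)))) : Prop :=
  ∃ H : ZMod (2 * n) → Matrix (ZMod (2 * n)) (Fin n) (ZMod 2),
    IsQuasiCCodeMatrix n κ H ∧ DescribesCode C H

/-- The columns constructed from `S`: `C_i = S_{i mod κ} + κ⌊i/κ⌋`. -/
def starterColumns {n κ : ℕ} [NeZero κ] (S : Fin κ → Set (Sym2 (ZMod (2 * n)))) :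
    ZMod (2 * n) → Set (Sym2 (ZMod (2 * n))) :=
  fun i => translatePairs ((κ * (i.val / κ) : ℕ) : ZMod (2 * n)) (S (Fin.ofNat κ i.val))

/-! ### The explicit even 2-starter -/

/-- The discrete logarithm to base `g`: the least exponent `i` with `g ^ i = x`. -/
noncomputable def dlog {p : ℕ} (g x : (ZMod p)ˣ) : ℕ :=
  sInf {i : ℕ | g ^ i = x}

/-- The set `C_0^A` of pairs `{log x, log y}` in `Z_{p-1}` with `x + y = 1`, `x, y ∉ {1, 1/2}`. -/
def pairsA (p : ℕ) (g : (ZMod p)ˣ) : Set (Sym2 (ZMod (p - 1))) :=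
  {e | ∃ x y : (ZMod p)ˣ, (x : ZMod p) ≠ 1 ∧ (x : ZMod p) ≠ 2⁻¹ ∧
    (y : ZMod p) ≠ 1 ∧ (y : ZMod p) ≠ 2⁻¹ ∧ (x : ZMod p) + (y : ZMod p) = 1 ∧
    e = s(((dlog g x : ℕ) : ZMod (p - 1)), ((dlog g y : ℕ) : ZMod (p - 1)))}

/-- The map `x ↦ 2x + c` from `Z_n` to `Z_{2n}`. -/
def doubleAdd (n c : ℕ) (x : ZMod n) : ZMod (2 * n) := ((2 * x.val + c : ℕ) : ZMod (2 * n))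

/-- `S_0`: the pairs `{2 log x, 2 log y + 1}` with `x ≠ 1`, `y ≠ -1`, `x - y = 1`. -/
def starterZero (p : ℕ) (g : (ZMod p)ˣ) : Set (Sym2 (ZMod (2 * (p - 1)))) :=
  {e | ∃ x y : (ZMod p)ˣ, (x : ZMod p) ≠ 1 ∧ (y : ZMod p) ≠ -1 ∧
    (x : ZMod p) - (y : ZMod p) = 1 ∧
    e = s(((2 * dlog g x : ℕ) : ZMod (2 * (p - 1))),
      ((2 * dlog g y + 1 : ℕ) : ZMod (2 * (p - 1))))}

/-- `S_1`: the pairs `{2x + 1, 2y + 1}` and `{2x, 2y}` for `{x, y} ∈ C_0^A`, and `{2r, 2r + 1}` for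
the non-zero `r ∈ Z_{p-1}` that does not occur in `C_0^A`. -/
def starterOne (p : ℕ) (g : (ZMod p)ˣ) : Set (Sym2 (ZMod (2 * (p - 1)))) :=
  Sym2.map (doubleAdd (p - 1) 1) '' pairsA p g ∪ Sym2.map (doubleAdd (p - 1) 0) '' pairsA p g ∪
    {e | ∃ r : ZMod (p - 1), r ≠ 0 ∧ (∀ f ∈ pairsA p g, r ∉ f) ∧
      e = s(doubleAdd (p - 1) 0 r, doubleAdd (p - 1) 1 r)}

/-- `S'_1`: the pairs `{2 log x + 1, 2 log y}` with `x ≠ 1`, `y ≠ -1`, `x - y = 1`. -/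
def twinOne (p : ℕ) (g : (ZMod p)ˣ) : Set (Sym2 (ZMod (2 * (p - 1)))) :=
  {e | ∃ x y : (ZMod p)ˣ, (x : ZMod p) ≠ 1 ∧ (y : ZMod p) ≠ -1 ∧
    (x : ZMod p) - (y : ZMod p) = 1 ∧
    e = s(((2 * dlog g x + 1 : ℕ) : ZMod (2 * (p - 1))),
      ((2 * dlog g y : ℕ) : ZMod (2 * (p - 1))))}

/-- The even 2-starter `S² = {S_0, S_1}`. -/
def starterS (p : ℕ) (g : (ZMod p)ˣ) : Fin 2 → Set (Sym2 (ZMod (2 * (p - 1)))) :=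
  ![starterZero p g, starterOne p g]

/-- Its twin `{S'_0, S'_1}` with `S'_0 = S_1`. -/
def twinS (p : ℕ) (g : (ZMod p)ˣ) : Fin 2 → Set (Sym2 (ZMod (2 * (p - 1)))) :=
  ![starterOne p g, twinOne p g]

instance neZero_prime_pred (p : ℕ) [hp : Fact p.Prime] : NeZero (p - 1) :=
  ⟨Nat.sub_ne_zero_of_lt hp.out.one_lt⟩

/-! Everything is transported to the vertex set $Z_2 \times Z_p$, two layers of $Z_p$. There the
reflection factor of $c$ pairs $x$ with $c - x$ inside each layer and joins the two copies of the
fixed point $c/2$; the shift factor of $c \neq 0$ pairs $(0,x)$ with $(1,y)$ for $x - y = c$. These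
$2p-1$ factors are `layerFactors`. The Chinese remainder theorem identifies them with $GA_{2p}$
(`relabel_GA`). The logarithmic coordinates $(a,x) \mapsto 2\log_g x + a$, with $(0,0) \mapsto
\infty_2$ and $(1,0) \mapsto \infty_1$, identify them with the completed family of the starter
(`completedFactorization_starterS`): translation by $2m$ becomes multiplication of the second
coordinate by $g^m$, the expanded $S_0$ and $S_1$ become the shift and the reflection factor of $1$,
their translates run through all $c \neq 0$, and the missing reflection factor of $0$ is the factor
`lastFactor`, because adding $p-1$ is multiplication by $-1$.

Perfectness is checked in this model. Following edges of two factors alternately moves a vertex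
within its layer by $c-d$ (two factors of the same kind) or by $2d$ (a reflection and the shift by
$d$). This step is non-zero and $p$ is prime, so it links a whole layer, and some edge joins the
layers. Two disjoint one-factors with connected union form a Hamiltonian cycle.

The rest holds for general $\kappa$ and follows from the induced family being a (perfect)
one-factorization. Counting edges gives the starter axioms
(`isEvenMultiStarter_of_isOneFactorization`). The twin re-indexes the same factors by the neighbour
of $\infty_2$ instead of $\infty_1$ (`inducedFactorization_twin`). Nonsingularity of the code blocks
is connectedness of the union of two factors, read over the field with two elements
(`eq_zero_of_constant_on_columns`). -/

/-- Edge sets that link all vertices: a property constant along the edges is constant. -/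
def IsSpanningEdgeSet {V : Type*} (E : Set (Sym2 V)) : Prop :=
  ∀ P : V → Prop, (∀ x y, s(x, y) ∈ E → P x → P y) → ∀ x y, P x → P y

/-! ### One-factors, and unions of two of them -/

namespace IsOneFactor

variable {V W : Type*} {F F' : Set (Sym2 V)}

theorem ne (h : IsOneFactor F) {x y : V} (he : s(x, y) ∈ F) : x ≠ y :=
  fun hxy => h.1 _ he (by simpa using hxy)

theorem exists_mem (h : IsOneFactor F) (x : V) : ∃ y, s(x, y) ∈ F := by
  obtain ⟨e, ⟨he, hx⟩, -⟩ := h.2 x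
  obtain ⟨y, rfl⟩ := hx
  exact ⟨y, he⟩

theorem edge_unique (h : IsOneFactor F) {x : V} {e f : Sym2 V} (he : e ∈ F) (hf : f ∈ F)
    (hxe : x ∈ e) (hxf : x ∈ f) : e = f :=
  (h.2 x).unique ⟨he, hxe⟩ ⟨hf, hxf⟩

theorem mem_unique (h : IsOneFactor F) {x y z : V} (hy : s(x, y) ∈ F) (hz : s(x, z) ∈ F) :
    y = z :=
  Sym2.congr_right.1 (h.edge_unique hy hz (Sym2.mem_mk_left x y) (Sym2.mem_mk_left x z))

theorem image (h : IsOneFactor F) (φ : V ≃ W) : IsOneFactor (Sym2.map φ '' F) := by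
  refine ⟨?_, fun v => ?_⟩
  · rintro _ ⟨e, he, rfl⟩
    induction e with | _ x y
    have := h.ne he
    simpa using this
  · obtain ⟨e, ⟨he, hv⟩, hu⟩ := h.2 (φ.symm v)
    refine ⟨Sym2.map φ e, ⟨⟨e, he, rfl⟩, Sym2.mem_map.2 ⟨_, hv, by simp⟩⟩, ?_⟩
    rintro _ ⟨⟨f, hf, rfl⟩, hvf⟩
    obtain ⟨x, hx, rfl⟩ := Sym2.mem_map.1 hvf
    rw [hu f ⟨hf, by simpa using hx⟩]

/-- The two ends of an edge carry equal weights, which cancel in characteristic two, and the edges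
partition the vertices. -/
theorem sum_eq_zero [Fintype V] (h : IsOneFactor F) (w : V → ZMod 2)
    (hw : ∀ x y, s(x, y) ∈ F → w x = w y) : ∑ v, w v = 0 := by
  choose σ hσ using h.exists_mem
  refine Finset.sum_involution (fun v _ => σ v) (fun v _ => ?_) (fun v _ _ => (h.ne (hσ v)).symm)
    (fun v _ => Finset.mem_univ _) (fun v _ => ?_)
  · rw [← hw _ _ (hσ v)]
    exact CharTwo.add_self_eq_zero _
  · exact h.mem_unique (hσ _) (Sym2.eq_swap ▸ hσ v)

/-- The union is 2-regular, so its components are cycles; connectedness leaves a single one. -/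
theorem isHamiltonianCycleEdgeSet_union [Finite V] [DecidableEq V] [Nonempty V]
    (h : IsOneFactor F) (h' : IsOneFactor F') (hd : Disjoint F F')
    (hc : IsSpanningEdgeSet (F ∪ F')) : IsHamiltonianCycleEdgeSet (F ∪ F') := by
  classical
  have := Fintype.ofFinite V
  have hadj : ∀ x y, (SimpleGraph.fromEdgeSet (F ∪ F')).Adj x y ↔ s(x, y) ∈ F ∪ F' := by
    intro x y
    rw [SimpleGraph.fromEdgeSet_adj]
    exact ⟨fun h => h.1, fun hxy => ⟨hxy, hxy.elim h.ne h'.ne⟩⟩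
  set G := SimpleGraph.fromEdgeSet (F ∪ F') with hG
  have hreach : ∀ x y, G.Reachable x y := fun x y =>
    hc (fun z => G.Reachable x z)
      (fun a b hab ha => ha.trans ((hadj a b).2 hab).reachable) x y (SimpleGraph.Reachable.refl _)
  -- Each vertex has one neighbour in each factor; disjointness makes these two neighbours
  -- different.
  have hcyc : G.IsCycles := by
    intro v _
    obtain ⟨a, ha⟩ := h.exists_mem v
    obtain ⟨b, hb⟩ := h'.exists_mem v
    rw [Set.ncard_eq_two]
    refine ⟨a, b, ?_, ?_⟩
    · rintro rfl
      exact Set.disjoint_left.1 hd ha hb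
    · ext z
      rw [SimpleGraph.mem_neighborSet, hadj]
      constructor
      · rintro (hz | hz)
        · exact Or.inl (h.mem_unique hz ha)
        · exact Or.inr (h'.mem_unique hz hb)
      · rintro (rfl | rfl)
        · exact Or.inl ha
        · exact Or.inr hb
  obtain ⟨v⟩ := ‹Nonempty V›
  obtain ⟨a, ha⟩ := h.exists_mem v
  obtain ⟨p, hp, hverts⟩ := hcyc.exists_cycle_toSubgraph_verts_eq_connectedComponentSupp
    (c := G.connectedComponentMk v) rfl ⟨a, (hadj v a).2 (Or.inl ha)⟩
  have hmem : ∀ x, x ∈ p.support := fun x => by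
    rw [← SimpleGraph.Walk.mem_verts_toSubgraph, hverts]
    exact SimpleGraph.ConnectedComponent.sound (hreach x v)
  refine ⟨v, p, ?_, ?_⟩
  · rw [SimpleGraph.Walk.isHamiltonianCycle_iff_isCycle_and_support_count_tail_eq_one]
    refine ⟨hp, fun x => List.count_eq_one_of_mem hp.support_nodup ?_⟩
    have hx := hmem x
    rw [← SimpleGraph.Walk.cons_tail_support] at hx
    rcases List.mem_cons.1 hx with rfl | hx
    · exact SimpleGraph.Walk.end_mem_tail_support hp.not_nil
    · exact hx
  · ext e
    induction e with | _ x y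
    rw [Set.mem_ofPred_eq, ← SimpleGraph.Walk.adj_toSubgraph_iff_mem_edges,
      hp.adj_toSubgraph_iff_of_isCycles hcyc (SimpleGraph.Walk.mem_verts_toSubgraph _ |>.2 (hmem x)),
      hadj]

end IsOneFactor

theorem IsHamiltonianCycleEdgeSet.isSpanningEdgeSet {V : Type*} [DecidableEq V]
    {E : Set (Sym2 V)} (h : IsHamiltonianCycleEdgeSet E) : IsSpanningEdgeSet E := by
  obtain ⟨v, w, hw, -⟩ := h
  intro P hP
  have key : ∀ {a b : V}, (SimpleGraph.fromEdgeSet E).Walk a b → P a → P b := by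
    intro a b q
    induction q with
    | nil => exact id
    | cons hab _ ih => exact fun ha => ih (hP _ _ ((SimpleGraph.fromEdgeSet_adj _).1 hab).1 ha)
  intro x y hx
  exact key (w.takeUntil y (hw.mem_support y)) (key (w.takeUntil x (hw.mem_support x)).reverse hx)

theorem IsSpanningEdgeSet.image {V W : Type*} {E : Set (Sym2 V)} (h : IsSpanningEdgeSet E)
    (φ : V ≃ W) : IsSpanningEdgeSet (Sym2.map φ '' E) := by
  intro P hP x y hx
  have := h (fun v => P (φ v)) (fun a b hab => hP _ _ ⟨_, hab, rfl⟩) (φ.symm x) (φ.symm y)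
  simpa [hx] using this

/-! ### Perfect one-factorizations: connectivity criterion, relabelling, removal of a factor -/

section Factorization

variable {V W : Type*} {FF : Set (Set (Sym2 V))}

theorem IsOneFactorization.disjoint {G : SimpleGraph V} (h : IsOneFactorization G FF)
    {F F' : Set (Sym2 V)} (hF : F ∈ FF) (hF' : F' ∈ FF) (hne : F ≠ F') : Disjoint F F' :=
  Set.disjoint_left.2 fun e he he' =>
    hne ((h.2.2 e (h.2.1 F hF he)).unique ⟨hF, he⟩ ⟨hF', he'⟩)

/-- Distinct factors of a one-factorization are disjoint, so only connectedness of their union has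
to be tested. Connectedness, unlike a Hamiltonian walk, passes through bijections without effort. -/
theorem isPerfectOneFactorization_iff [Finite V] [DecidableEq V] [Nonempty V]
    {G : SimpleGraph V} : IsPerfectOneFactorization G FF ↔ IsOneFactorization G FF ∧
      ∀ F ∈ FF, ∀ F' ∈ FF, F ≠ F' → IsSpanningEdgeSet (F ∪ F') := by
  refine and_congr_right fun h => ⟨fun hp F hF F' hF' hne => (hp F hF F' hF' hne).isSpanningEdgeSet,
    fun hp F hF F' hF' hne => ?_⟩
  exact (h.1 F hF).isHamiltonianCycleEdgeSet_union (h.1 F' hF') (h.disjoint hF hF' hne)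
    (hp F hF F' hF' hne)

theorem isOneFactorization_top_iff : IsOneFactorization (⊤ : SimpleGraph V) FF ↔
    (∀ F ∈ FF, IsOneFactor F) ∧ ∀ x y : V, x ≠ y → ∃! F : Set (Sym2 V), F ∈ FF ∧ s(x, y) ∈ F := by
  constructor
  · exact fun h => ⟨h.1, fun x y hxy => h.2.2 _ (by simpa using hxy)⟩
  · refine fun h => ⟨h.1, fun F hF e he => ?_, fun e he => ?_⟩
    · induction e with | _ x y
      simpa using (h.1 F hF).ne he
    · induction e with | _ x y
      exact h.2 x y (by simpa using he)

theorem relabel_trans {U : Type*} (φ : V ≃ W) (ψ : W ≃ U) :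
    relabel ψ (relabel φ FF) = relabel (φ.trans ψ) FF := by
  simp only [relabel, Set.image_image, Sym2.map_map]
  rfl

theorem relabel_refl : relabel (Equiv.refl V) FF = FF := by
  simp [relabel]

theorem mem_map_image_iff (φ : V ≃ W) (F : Set (Sym2 V)) (x y : W) :
    s(x, y) ∈ Sym2.map φ '' F ↔ s(φ.symm x, φ.symm y) ∈ F := by
  constructor
  · rintro ⟨e, he, h⟩
    rw [show s(φ.symm x, φ.symm y) = Sym2.map φ.symm s(x, y) from rfl, ← h, Sym2.map_map]
    simpa using he
  · exact fun h => ⟨_, h, by simp⟩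

theorem IsOneFactorization.relabel_top (h : IsOneFactorization (⊤ : SimpleGraph V) FF)
    (φ : V ≃ W) : IsOneFactorization (⊤ : SimpleGraph W) (relabel φ FF) := by
  rw [isOneFactorization_top_iff] at h ⊢
  refine ⟨?_, fun x y hxy => ?_⟩
  · rintro _ ⟨F, hF, rfl⟩
    exact (h.1 F hF).image φ
  · obtain ⟨F, ⟨hF, hxF⟩, hu⟩ := h.2 (φ.symm x) (φ.symm y) (by simpa using hxy)
    refine ⟨_, ⟨⟨F, hF, rfl⟩, (mem_map_image_iff φ F x y).2 hxF⟩, ?_⟩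
    rintro _ ⟨⟨F', hF', rfl⟩, hx'⟩
    rw [hu F' ⟨hF', (mem_map_image_iff φ F' x y).1 hx'⟩]

theorem IsPerfectOneFactorization.relabel_top [Finite V] [DecidableEq V] [Nonempty V]
    [DecidableEq W] (h : IsPerfectOneFactorization (⊤ : SimpleGraph V) FF) (φ : V ≃ W) :
    IsPerfectOneFactorization (⊤ : SimpleGraph W) (relabel φ FF) := by
  have := Finite.of_equiv V φ
  have := φ.nonempty_congr.1 ‹_›
  rw [isPerfectOneFactorization_iff] at h ⊢
  refine ⟨h.1.relabel_top φ, ?_⟩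
  rintro _ ⟨F, hF, rfl⟩ _ ⟨F', hF', rfl⟩ hne
  rw [← Set.image_union]
  exact (h.2 F hF F' hF' (fun h => hne (by rw [h]))).image φ

/-- Leads from the completed family on the complete graph back to the induced family on the graph
without the last factor. -/
theorem IsPerfectOneFactorization.deleteEdges [DecidableEq V] {L : Set (Sym2 V)}
    (h : IsPerfectOneFactorization (⊤ : SimpleGraph V) (insert L FF)) (hL : L ∉ FF) :
    IsPerfectOneFactorization ((⊤ : SimpleGraph V).deleteEdges L) FF := by
  refine ⟨⟨fun F hF => h.1.1 F (Or.inr hF), fun F hF e he => ?_, fun e he => ?_⟩,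
    fun F hF F' hF' => h.2 F (Or.inr hF) F' (Or.inr hF')⟩
  · rw [SimpleGraph.edgeSet_deleteEdges]
    exact ⟨h.1.2.1 F (Or.inr hF) he, Set.disjoint_left.1
      (h.1.disjoint (Or.inr hF) (Or.inl rfl) (fun h => hL (h ▸ hF))) he⟩
  · rw [SimpleGraph.edgeSet_deleteEdges] at he
    obtain ⟨F, ⟨hF, heF⟩, hu⟩ := h.1.2.2 e he.1
    rcases hF with rfl | hF
    · exact absurd heF he.2
    · exact ⟨F, ⟨hF, heF⟩, fun F' hF' => hu F' ⟨Or.inr hF'.1, hF'.2⟩⟩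

end Factorization

/-- The one-factor of all edges `{v, σ v}`. -/
def involutionFactor {V : Type*} (σ : V → V) : Set (Sym2 V) :=
  {e | ∃ v, e = s(v, σ v)}

theorem mk_mem_involutionFactor {V : Type*} {σ : V → V} (hσ : Function.Involutive σ) {x y : V} :
    s(x, y) ∈ involutionFactor σ ↔ y = σ x := by
  constructor
  · rintro ⟨v, hv⟩
    rcases Sym2.eq_iff.1 hv with ⟨rfl, rfl⟩ | ⟨rfl, rfl⟩
    · rfl
    · exact (hσ _).symm
  · rintro rfl
    exact ⟨x, rfl⟩

theorem isOneFactor_involutionFactor {V : Type*} {σ : V → V} (hσ : Function.Involutive σ)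
    (hne : ∀ v, σ v ≠ v) : IsOneFactor (involutionFactor σ) := by
  refine ⟨?_, fun v => ⟨s(v, σ v), ⟨⟨v, rfl⟩, Sym2.mem_mk_left _ _⟩, ?_⟩⟩
  · rintro _ ⟨v, rfl⟩ h
    exact hne v (by simpa using h.symm)
  · rintro e ⟨he, w, rfl⟩
    rw [(mk_mem_involutionFactor hσ).1 he]

/-! ### The model of the factorization on two layers of residues mod p -/

section Model

variable {p : ℕ}

/-- Reflection `x ↦ c - x` in both layers; the two copies of its fixed point are interchanged. -/
def layerReflection (c : ZMod p) (v : ZMod 2 × ZMod p) : ZMod 2 × ZMod p :=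
  if 2 * v.2 = c then (v.1 + 1, v.2) else (v.1, c - v.2)

/-- The involution that links `(0, x)` and `(1, y)` for `x - y = c`. -/
def layerShift (c : ZMod p) (v : ZMod 2 × ZMod p) : ZMod 2 × ZMod p :=
  if v.1 = 0 then (1, v.2 - c) else (0, v.2 + c)

theorem ZMod.two_cases (a : ZMod 2) : a = 0 ∨ a = 1 := by
  revert a; decide

theorem layerShift_zero (c x : ZMod p) : layerShift c (0, x) = (1, x - c) := if_pos rfl

theorem layerShift_one (c x : ZMod p) : layerShift c (1, x) = (0, x + c) :=
  if_neg (by decide : (1 : ZMod 2) ≠ 0)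

theorem layerReflection_of_eq {c x : ZMod p} (h : 2 * x = c) (a : ZMod 2) :
    layerReflection c (a, x) = (a + 1, x) := if_pos h

theorem layerReflection_of_ne {c x : ZMod p} (h : 2 * x ≠ c) (a : ZMod 2) :
    layerReflection c (a, x) = (a, c - x) := if_neg h

theorem layerShift_involutive (c : ZMod p) : Function.Involutive (layerShift c) := by
  rintro ⟨a, x⟩
  rcases ZMod.two_cases a with rfl | rfl
  · rw [layerShift_zero, layerShift_one, sub_add_cancel]
  · rw [layerShift_one, layerShift_zero, add_sub_cancel_right]

theorem layerShift_ne (c : ZMod p) (v : ZMod 2 × ZMod p) : layerShift c v ≠ v := by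
  obtain ⟨a, x⟩ := v
  rcases ZMod.two_cases a with rfl | rfl
  · rw [layerShift_zero]
    exact fun h => absurd (congrArg Prod.fst h) one_ne_zero
  · rw [layerShift_one]
    exact fun h => absurd (congrArg Prod.fst h) zero_ne_one

theorem layerReflection_involutive (c : ZMod p) : Function.Involutive (layerReflection c) := by
  rintro ⟨a, x⟩
  by_cases h : 2 * x = c
  · rw [layerReflection_of_eq h, layerReflection_of_eq h, add_assoc,
      show (1 + 1 : ZMod 2) = 0 from rfl, add_zero]
  · rw [layerReflection_of_ne h, layerReflection_of_ne, sub_sub_cancel]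
    intro h'
    apply h
    linear_combination - h'

theorem layerReflection_ne (c : ZMod p) (v : ZMod 2 × ZMod p) : layerReflection c v ≠ v := by
  obtain ⟨a, x⟩ := v
  by_cases h : 2 * x = c
  · rw [layerReflection_of_eq h]
    exact fun h => absurd (congrArg Prod.fst h) (by simp)
  · rw [layerReflection_of_ne h]
    intro h'
    apply h
    have : c - x = x := congrArg Prod.snd h'
    linear_combination - this

/-- The factors of `GA_{2p}` in coordinates. -/
def layerFactors (p : ℕ) : Set (Set (Sym2 (ZMod 2 × ZMod p))) :=
  {F | ∃ c, F = involutionFactor (layerReflection c)} ∪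
    {F | ∃ c, c ≠ 0 ∧ F = involutionFactor (layerShift c)}

theorem mem_layerReflection_same {c x y : ZMod p} {a : ZMod 2} (hxy : x ≠ y) :
    s((a, x), (a, y)) ∈ involutionFactor (layerReflection c) ↔ x + y = c := by
  rw [mk_mem_involutionFactor (layerReflection_involutive c)]
  by_cases h : 2 * x = c
  · rw [layerReflection_of_eq h]
    constructor
    · exact fun h => absurd (congrArg Prod.snd h).symm hxy
    · intro h'
      exact absurd (by linear_combination h - h') hxy
  · rw [layerReflection_of_ne h, Prod.mk.injEq, eq_sub_iff_add_eq', and_iff_right rfl]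

theorem mem_layerReflection_zero_one {c x y : ZMod p} :
    s(((0 : ZMod 2), x), ((1 : ZMod 2), y)) ∈ involutionFactor (layerReflection c) ↔
      x = y ∧ 2 * x = c := by
  rw [mk_mem_involutionFactor (layerReflection_involutive c)]
  by_cases h : 2 * x = c
  · rw [layerReflection_of_eq h, Prod.mk.injEq]
    exact ⟨fun h' => ⟨h'.2.symm, h⟩, fun h' => ⟨(zero_add 1).symm, h'.1.symm⟩⟩
  · rw [layerReflection_of_ne h, Prod.mk.injEq]
    exact ⟨fun h' => absurd h'.1 (by decide), fun h' => absurd h'.2 h⟩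

theorem mem_layerShift_same {c x y : ZMod p} {a : ZMod 2} :
    s((a, x), (a, y)) ∉ involutionFactor (layerShift c) := by
  rw [mk_mem_involutionFactor (layerShift_involutive c)]
  rcases ZMod.two_cases a with rfl | rfl
  · rw [layerShift_zero]
    exact fun h => absurd (congrArg Prod.fst h) zero_ne_one
  · rw [layerShift_one]
    exact fun h => absurd (congrArg Prod.fst h) one_ne_zero

theorem mem_layerShift_zero_one {c x y : ZMod p} :
    s(((0 : ZMod 2), x), ((1 : ZMod 2), y)) ∈ involutionFactor (layerShift c) ↔ x - y = c := by
  rw [mk_mem_involutionFactor (layerShift_involutive c), layerShift_zero, Prod.mk.injEq,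
    and_iff_right rfl, eq_sub_iff_add_eq', ← eq_sub_iff_add_eq, eq_comm]

theorem isOneFactorization_layerFactors :
    IsOneFactorization (⊤ : SimpleGraph (ZMod 2 × ZMod p)) (layerFactors p) := by
  rw [isOneFactorization_top_iff]
  constructor
  · rintro _ (⟨c, rfl⟩ | ⟨c, -, rfl⟩)
    · exact isOneFactor_involutionFactor (layerReflection_involutive c) (layerReflection_ne c)
    · exact isOneFactor_involutionFactor (layerShift_involutive c) (layerShift_ne c)
  · have mixed : ∀ x y : ZMod p, ∃! F : Set (Sym2 (ZMod 2 × ZMod p)),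
        F ∈ layerFactors p ∧ s((0, x), (1, y)) ∈ F := by
      intro x y
      by_cases hxy : x = y
      · refine ⟨_, ⟨Or.inl ⟨2 * x, rfl⟩, mem_layerReflection_zero_one.2 ⟨hxy, rfl⟩⟩, ?_⟩
        rintro _ ⟨⟨c, rfl⟩ | ⟨c, hc, rfl⟩, h⟩
        · rw [← (mem_layerReflection_zero_one.1 h).2]
        · exact absurd ((mem_layerShift_zero_one.1 h).symm.trans (sub_eq_zero.2 hxy)) hc
      · refine ⟨_, ⟨Or.inr ⟨x - y, sub_ne_zero.2 hxy, rfl⟩, mem_layerShift_zero_one.2 rfl⟩, ?_⟩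
        rintro _ ⟨⟨c, rfl⟩ | ⟨c, hc, rfl⟩, h⟩
        · exact absurd (mem_layerReflection_zero_one.1 h).1 hxy
        · rw [mem_layerShift_zero_one.1 h]
    have same : ∀ (a : ZMod 2) (x y : ZMod p), x ≠ y → ∃! F : Set (Sym2 (ZMod 2 × ZMod p)),
        F ∈ layerFactors p ∧ s((a, x), (a, y)) ∈ F := by
      intro a x y hxy
      refine ⟨_, ⟨Or.inl ⟨x + y, rfl⟩, (mem_layerReflection_same hxy).2 rfl⟩, ?_⟩
      rintro _ ⟨⟨c, rfl⟩ | ⟨c, hc, rfl⟩, h⟩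
      · rw [(mem_layerReflection_same hxy).1 h]
      · exact absurd h mem_layerShift_same
    rintro ⟨a, x⟩ ⟨b, y⟩ hne
    rcases ZMod.two_cases a with rfl | rfl <;> rcases ZMod.two_cases b with rfl | rfl
    · exact same _ _ _ (fun h => hne (by rw [h]))
    · exact mixed x y
    · rw [Sym2.eq_swap]
      exact mixed y x
    · exact same _ _ _ (fun h => hne (by rw [h]))

/-- A property of residues mod `p` that is stable under a non-zero shift is constant. -/
theorem ZMod.forall_of_shift [Fact p.Prime] {Q : ZMod p → Prop} {d : ZMod p} (hd : d ≠ 0)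
    (h : ∀ x, Q x → Q (x + d)) (x y : ZMod p) (hx : Q x) : Q y := by
  have key : ∀ k : ℕ, Q (x + k * d) := by
    intro k
    induction k with
    | zero => simpa using hx
    | succ k ih =>
      have := h _ ih
      rwa [add_assoc, ← add_one_mul, ← Nat.cast_succ] at this
  have := key ((y - x) / d).val
  rwa [ZMod.natCast_rightInverse, div_mul_cancel₀ _ hd, add_sub_cancel] at this

variable [Fact p.Prime]

/-- Multiples of a non-zero $d$ fill $Z_p$, so each layer is linked in itself, and a single edge
between the layers links the two. -/
theorem isSpanningEdgeSet_of_layers {E : Set (Sym2 (ZMod 2 × ZMod p))} {d : ZMod p} (hd : d ≠ 0)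
    (h0 : ∀ P : ZMod 2 × ZMod p → Prop, (∀ x y, s(x, y) ∈ E → P x → P y) →
      ∀ (a : ZMod 2) x, P (a, x) → P (a, x + d))
    (h1 : ∃ x y, s(((0 : ZMod 2), x), ((1 : ZMod 2), y)) ∈ E) : IsSpanningEdgeSet E := by
  obtain ⟨x₀, y₀, h1⟩ := h1
  rintro P hP ⟨a, x⟩ ⟨b, y⟩ hx
  have layer := fun a x y => ZMod.forall_of_shift (Q := fun x => P (a, x)) hd (h0 P hP a) x y
  rcases ZMod.two_cases a with rfl | rfl <;> rcases ZMod.two_cases b with rfl | rfl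
  · exact layer _ _ _ hx
  · exact layer _ _ _ (hP _ _ h1 (layer _ x x₀ hx))
  · exact layer _ _ _ (hP _ _ (Sym2.eq_swap ▸ h1) (layer _ x y₀ hx))
  · exact layer _ _ _ hx

theorem isSpanningEdgeSet_layerShift {c d : ZMod p} (hcd : c ≠ d) : IsSpanningEdgeSet
    (involutionFactor (layerShift c) ∪ involutionFactor (layerShift d)) := by
  have mem0 : ∀ x (e : ZMod p), s(((0 : ZMod 2), x), ((1 : ZMod 2), x - e)) ∈
      involutionFactor (layerShift e) := fun x e => mem_layerShift_zero_one.2 (by ring)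
  have mem1 : ∀ x (e : ZMod p), s(((1 : ZMod 2), x), ((0 : ZMod 2), x + e)) ∈
      involutionFactor (layerShift e) := fun x e => by
    rw [Sym2.eq_swap]
    exact mem_layerShift_zero_one.2 (by ring)
  refine isSpanningEdgeSet_of_layers (sub_ne_zero.2 hcd) ?_ ⟨c, 0, Or.inl (by simpa using mem0 c c)⟩
  intro P hP a x hx
  rcases ZMod.two_cases a with rfl | rfl
  · have := hP _ _ (Or.inl (mem1 (x - d) c)) (hP _ _ (Or.inr (mem0 x d)) hx)
    rwa [show x - d + c = x + (c - d) by ring] at this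
  · have := hP _ _ (Or.inr (mem0 (x + c) d)) (hP _ _ (Or.inl (mem1 x c)) hx)
    rwa [show x + c - d = x + (c - d) by ring] at this

/-- The only edge that leaves its layer sits at the fixed point $x = c - x$, where nothing has to be
shown. -/
theorem reflect_of_constant {E : Set (Sym2 (ZMod 2 × ZMod p))} {c : ZMod p}
    (hE : involutionFactor (layerReflection c) ⊆ E) {P : ZMod 2 × ZMod p → Prop}
    (hP : ∀ x y, s(x, y) ∈ E → P x → P y) (a : ZMod 2) (x : ZMod p) (hx : P (a, x)) :
    P (a, c - x) := by
  by_cases h : 2 * x = c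
  · rwa [show c - x = x by linear_combination -h]
  · exact hP _ _ (hE ((mem_layerReflection_same (fun h' => h (by linear_combination h'))).2
      (by ring))) hx

theorem exists_mem_layerReflection (hp : p ≠ 2) (c : ZMod p) :
    s(((0 : ZMod 2), c / 2), ((1 : ZMod 2), c / 2)) ∈ involutionFactor (layerReflection c) :=
  have : NeZero (2 : ZMod p) := ⟨Ring.two_ne_zero (by rwa [ZMod.ringChar_zmod_n])⟩
  mem_layerReflection_zero_one.2 ⟨rfl, mul_div_cancel₀ _ two_ne_zero⟩

theorem isSpanningEdgeSet_layerReflection (hp : p ≠ 2) {c d : ZMod p} (hcd : c ≠ d) :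
    IsSpanningEdgeSet
      (involutionFactor (layerReflection c) ∪ involutionFactor (layerReflection d)) := by
  refine isSpanningEdgeSet_of_layers (sub_ne_zero.2 hcd) ?_
    ⟨_, _, Or.inl (exists_mem_layerReflection hp c)⟩
  intro P hP a x hx
  have := reflect_of_constant Set.subset_union_left hP a _
    (reflect_of_constant Set.subset_union_right hP a x hx)
  rwa [show c - (d - x) = x + (c - d) by ring] at this

theorem isSpanningEdgeSet_layerReflection_layerShift (hp : p ≠ 2) (c : ZMod p) {d : ZMod p}
    (hd : d ≠ 0) : IsSpanningEdgeSet
      (involutionFactor (layerReflection c) ∪ involutionFactor (layerShift d)) := by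
  have h2 : (2 : ZMod p) ≠ 0 := Ring.two_ne_zero (by rwa [ZMod.ringChar_zmod_n])
  -- Shift, reflection, shift, reflection: both passages between the layers move in the same
  -- direction after the reflections, which adds up to $2d$, non-zero since $p$ is odd.
  refine isSpanningEdgeSet_of_layers (d := 2 * d) (mul_ne_zero h2 hd) ?_
    ⟨_, _, Or.inl (exists_mem_layerReflection hp c)⟩
  intro P hP a x hx
  have mem0 : ∀ x, P (0, x) → P (1, x - d) := fun x =>
    hP _ _ (Or.inr (mem_layerShift_zero_one.2 (by ring)))
  have mem1 : ∀ x, P (1, x) → P (0, x + d) := fun x => hP _ _ (Or.inr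
    (Sym2.eq_swap ▸ mem_layerShift_zero_one.2 (by ring)))
  have refl := reflect_of_constant Set.subset_union_left hP
  rcases ZMod.two_cases a with rfl | rfl
  · have := mem1 _ (refl _ _ (mem0 _ (refl _ _ hx)))
    rwa [show c - (c - x - d) + d = x + 2 * d by ring] at this
  · have := refl _ _ (mem0 _ (refl _ _ (mem1 _ hx)))
    rwa [show c - (c - (x + d) - d) = x + 2 * d by ring] at this

theorem isPerfectOneFactorization_layerFactors (hp : p ≠ 2) :
    IsPerfectOneFactorization (⊤ : SimpleGraph (ZMod 2 × ZMod p)) (layerFactors p) := by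
  rw [isPerfectOneFactorization_iff]
  refine ⟨isOneFactorization_layerFactors, ?_⟩
  rintro _ (⟨c, rfl⟩ | ⟨c, hc, rfl⟩) _ (⟨d, rfl⟩ | ⟨d, hd, rfl⟩) hne
  · exact isSpanningEdgeSet_layerReflection hp (fun h => hne (by rw [h]))
  · exact isSpanningEdgeSet_layerReflection_layerShift hp c hd
  · rw [Set.union_comm]
    exact isSpanningEdgeSet_layerReflection_layerShift hp d hc
  · exact isSpanningEdgeSet_layerShift (fun h => hne (by rw [h]))

end Model

/-! ### Chinese remainder coordinates for the factorization GA -/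

section CoordinatesGA

variable {p : ℕ}

theorem eq_involutionFactor {V : Type*} {σ : V → V} {E : Set (Sym2 V)}
    (h₁ : E ⊆ involutionFactor σ) (h₂ : ∀ v, s(v, σ v) ∈ E) : E = involutionFactor σ := by
  refine h₁.antisymm ?_
  rintro _ ⟨v, rfl⟩
  exact h₂ v

/-- Under the Chinese remainder map $p$ becomes $(1,0)$ and the even elements are the layer $0$.
Hence $a + b = 2j$ says that $a, b$ lie in one layer with second coordinates summing to $2j$, and an
odd step $i$ joins the layers with difference $-i$, where $i \neq p$ means that this difference is
non-zero. -/
theorem relabel_GA [hF : Fact p.Prime] (hp : p ≠ 2) : ∃ φ : ZMod (2 * p) ≃ ZMod 2 × ZMod p,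
    relabel φ (GA p) = layerFactors p := by
  have h2 : (2 : ZMod p) ≠ 0 := Ring.two_ne_zero (by rwa [ZMod.ringChar_zmod_n])
  have hcop : Nat.Coprime 2 p := (Nat.coprime_primes Nat.prime_two hF.out).2 hp.symm
  have hodd : ((p : ℕ) : ZMod 2) = 1 :=
    (ZMod.natCast_eq_one_iff_odd).2 (hF.out.odd_of_ne_two hp)
  set φ := ZMod.chineseRemainder hcop
  have hφp : φ (p : ZMod (2 * p)) = (1, 0) := by
    rw [map_natCast]
    exact Prod.ext hodd (ZMod.natCast_self p)
  have heven : ∀ a, Even a ↔ (φ a).1 = 0 := by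
    intro a
    constructor
    · rintro ⟨b, rfl⟩
      rw [map_add, Prod.fst_add]
      exact CharTwo.add_self_eq_zero _
    · intro h
      refine ⟨φ.symm (0, (φ a).2 / 2), φ.injective ?_⟩
      rw [map_add, RingEquiv.apply_symm_apply]
      refine Prod.ext (by simpa using h) ?_
      simp only [Prod.snd_add]
      field_simp
      ring
  have hrefl : ∀ j, Sym2.map φ '' ({e | ∃ a b, a ≠ b ∧ a + b = 2 * j ∧ e = s(a, b)} ∪
      {s(j, j + (p : ZMod (2 * p)))}) = involutionFactor (layerReflection (2 * (φ j).2)) := by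
    intro j
    apply eq_involutionFactor
    · rintro _ ⟨e, ⟨a, b, hab, hs, rfl⟩ | rfl, rfl⟩
      · have hs' : φ a + φ b = 2 * φ j := by rw [← map_add, hs, map_mul, map_ofNat]
        have hfst : (φ a).1 = (φ b).1 := by
          have := congrArg Prod.fst hs'
          simp only [Prod.fst_add, Prod.fst_mul] at this
          have h20 : (2 : ZMod 2 × ZMod p).1 = 0 := rfl
          rw [h20, zero_mul] at this
          exact CharTwo.add_eq_zero.1 this
        have hsnd : (φ a).2 + (φ b).2 = 2 * (φ j).2 := congrArg Prod.snd hs'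
        have : s(φ a, φ b) = s(((φ a).1, (φ a).2), ((φ a).1, (φ b).2)) := by
          rw [show ((φ a).1, (φ b).2) = φ b from Prod.ext hfst rfl]
        rw [Sym2.map_mk, this, mem_layerReflection_same]
        · exact hsnd
        · exact fun h => hab (φ.injective (Prod.ext hfst h))
      · refine ⟨φ j, ?_⟩
        rw [Sym2.map_mk, map_add, hφp, layerReflection, if_pos rfl]
        congr 2
        exact Prod.ext rfl (add_zero _)
    · rintro ⟨a, x⟩
      by_cases h : 2 * x = 2 * (φ j).2
      · rw [layerReflection_of_eq h]
        have hx : x = (φ j).2 := mul_left_cancel₀ h2 h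
        refine ⟨_, Or.inr rfl, ?_⟩
        rw [Sym2.map_mk, map_add, hφp, Sym2.eq_iff]
        -- The vertex is one of the two copies of the fixed point: the image of $j$ or that of $j +
        -- p$.
        have ha : a = (φ j).1 ∨ a = (φ j).1 + 1 := by
          generalize (φ j).1 = b
          revert a b; decide
        rcases ha with ha | ha
        · exact Or.inl ⟨Prod.ext ha.symm hx.symm, Prod.ext (by simp [ha]) (by simp [hx])⟩
        · refine Or.inr ⟨Prod.ext ?_ hx.symm, Prod.ext (by simp [ha]) (by simp [hx])⟩
          rw [ha, add_assoc]
          exact (add_zero _).symm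
      · rw [layerReflection_of_ne h]
        refine ⟨s(φ.symm (a, x), φ.symm (a, 2 * (φ j).2 - x)), Or.inl ⟨_, _, ?_, ?_, rfl⟩, ?_⟩
        · intro h'
          have := congrArg Prod.snd (φ.symm.injective h')
          exact h (by linear_combination this)
        · apply φ.injective
          rw [map_add, RingEquiv.apply_symm_apply, RingEquiv.apply_symm_apply, map_mul, map_ofNat]
          refine Prod.ext ?_ ?_
          · change a + a = 0 * _
            rw [zero_mul]
            exact CharTwo.add_self_eq_zero _
          · exact add_sub_cancel _ _
        · simp
  have hshift : ∀ i, (φ i).1 = 1 → Sym2.map φ '' {e | ∃ a, Even a ∧ e = s(a, a + i)} =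
      involutionFactor (layerShift (-(φ i).2)) := by
    intro i hi
    apply eq_involutionFactor
    · rintro _ ⟨_, ⟨a, ha, rfl⟩, rfl⟩
      rw [heven] at ha
      refine ⟨φ a, ?_⟩
      rw [Sym2.map_mk, map_add, layerShift, if_pos ha]
      congr 2
      exact Prod.ext (by simp [ha, hi]) (by simp)
    · have mem : ∀ x, s(((0 : ZMod 2), x), ((1 : ZMod 2), x + (φ i).2)) ∈
          Sym2.map φ '' {e | ∃ a, Even a ∧ e = s(a, a + i)} := by
        refine fun x => ⟨_, ⟨φ.symm (0, x), (heven _).2 (by simp), rfl⟩, ?_⟩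
        rw [Sym2.map_mk, map_add, RingEquiv.apply_symm_apply]
        congr 2
        exact Prod.ext (by simp [hi]) rfl
      rintro ⟨a, x⟩
      rcases ZMod.two_cases a with rfl | rfl
      · rw [layerShift_zero, sub_neg_eq_add]
        exact mem x
      · rw [layerShift_one, Sym2.eq_swap]
        simpa using mem (x + -(φ i).2)
  refine ⟨φ.toEquiv, Set.Subset.antisymm ?_ ?_⟩
  · rintro _ ⟨_, ⟨j, rfl⟩ | ⟨i, hi, hip, rfl⟩, rfl⟩
    · exact Or.inl ⟨_, hrefl j⟩
    · have hi1 : (φ i).1 = 1 := (ZMod.two_cases _).resolve_left (fun h => hi ((heven i).2 h))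
      refine Or.inr ⟨_, ?_, hshift i hi1⟩
      intro h0
      apply hip
      apply φ.injective
      rw [hφp]
      exact Prod.ext hi1 (neg_eq_zero.1 h0)
  · rintro _ (⟨c, rfl⟩ | ⟨c, hc, rfl⟩)
    · refine ⟨_, Or.inl ⟨φ.symm (0, c / 2), rfl⟩, (hrefl _).trans ?_⟩
      rw [RingEquiv.apply_symm_apply, mul_div_cancel₀ _ h2]
    · refine ⟨_, Or.inr ⟨φ.symm (1, -c), ?_, ?_, rfl⟩, (hshift _ (by simp)).trans ?_⟩
      · rw [heven]
        simp
      · intro h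
        have := congrArg φ h
        rw [hφp, RingEquiv.apply_symm_apply] at this
        exact hc (neg_eq_zero.1 (congrArg Prod.snd this))
      · simp

end CoordinatesGA

/-! ### Translates of sets of pairs, edge counts and residues mod κ -/

section TranslatePairs

variable {N : ℕ}

theorem mk_mem_translatePairs {c x y : ZMod N} {A : Set (Sym2 (ZMod N))} :
    s(x, y) ∈ translatePairs c A ↔ s(x - c, y - c) ∈ A := by
  rw [translatePairs]
  constructor
  · rintro ⟨e, he, h⟩
    rw [show s(x - c, y - c) = Sym2.map (fun z => z - c) s(x, y) from rfl, ← h, Sym2.map_map]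
    simpa [Function.comp_def] using he
  · exact fun h => ⟨_, h, by simp⟩

theorem translatePairs_translatePairs (c d : ZMod N) (A : Set (Sym2 (ZMod N))) :
    translatePairs c (translatePairs d A) = translatePairs (c + d) A := by
  ext e
  induction e with | _ x y
  simp only [mk_mem_translatePairs, sub_sub]

theorem translatePairs_zero (A : Set (Sym2 (ZMod N))) : translatePairs 0 A = A := by
  ext e
  induction e with | _ x y
  simp only [mk_mem_translatePairs, sub_zero]

theorem forall_translatePairs_notMem {c r : ZMod N} {A : Set (Sym2 (ZMod N))} :
    (∀ f ∈ translatePairs c A, r ∉ f) ↔ ∀ f ∈ A, r - c ∉ f := by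
  constructor
  · intro h f hf hr
    refine h _ ⟨f, hf, rfl⟩ (Sym2.mem_map.2 ⟨_, hr, add_sub_cancel _ _⟩)
  · rintro h _ ⟨f, hf, rfl⟩ hr
    obtain ⟨x, hx, rfl⟩ := Sym2.mem_map.1 hr
    exact h f hf (by simpa using hx)

end TranslatePairs

theorem IsOneFactor.two_mul_ncard {V : Type*} [Fintype V] {F : Set (Sym2 V)}
    (h : IsOneFactor F) : 2 * F.ncard = Fintype.card V := by
  classical
  have hfin : F.Finite := Set.toFinite F
  choose f hf using fun v => (h.2 v).exists
  rw [Set.ncard_eq_toFinset_card F hfin, ← Finset.card_univ,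
    Finset.card_eq_sum_card_fiberwise (f := f) (t := hfin.toFinset)
      (fun v _ => by simpa using (hf v).1),
    Finset.sum_congr rfl (g := fun _ => 2), Finset.sum_const, smul_eq_mul, mul_comm]
  intro e he
  rw [Set.Finite.mem_toFinset] at he
  rw [← Sym2.card_toFinset_of_not_isDiag e (h.1 e he)]
  congr 1
  ext v
  simp only [Finset.mem_filter, Finset.mem_univ, true_and, Sym2.mem_toFinset]
  constructor
  · rintro rfl
    exact (hf v).2
  · exact fun hv => h.edge_unique (hf v).1 he (hf v).2 hv

section Residues

variable {n κ : ℕ} [NeZero κ]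

theorem ofNat_val_add_mul [NeZero n] (hκ : κ ∣ 2 * n) (k t : ZMod (2 * n)) :
    Fin.ofNat κ (k + κ * t).val = Fin.ofNat κ k.val := by
  apply Fin.ext
  change (k + κ * t).val % κ = k.val % κ
  rw [← ZMod.natCast_eq_natCast_iff', ZMod.natCast_val, ZMod.natCast_val,
    ← ZMod.castHom_apply (R := ZMod κ) (h := hκ), ← ZMod.castHom_apply (R := ZMod κ) (h := hκ), map_add,
    map_mul, map_natCast, ZMod.natCast_self, zero_mul, add_zero]

theorem ofNat_val_natCast (hκ : κ ∣ 2 * n) (m : ℕ) :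
    Fin.ofNat κ ((m : ZMod (2 * n))).val = Fin.ofNat κ m := by
  apply Fin.ext
  change (m : ZMod (2 * n)).val % κ = m % κ
  rw [ZMod.val_natCast, Nat.mod_mod_of_dvd _ hκ]

theorem natCast_ofNat_add_mul_div [NeZero n] (k : ZMod (2 * n)) :
    (((Fin.ofNat κ k.val : Fin κ) : ℕ) : ZMod (2 * n)) +
      ((κ * (k.val / κ) : ℕ) : ZMod (2 * n)) = k := by
  rw [← Nat.cast_add, Fin.val_ofNat, Nat.mod_add_div, ZMod.natCast_rightInverse]

theorem natCast_mul_div [NeZero n] (k : ZMod (2 * n)) : ((κ * (k.val / κ) : ℕ) : ZMod (2 * n)) =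
    k - (((Fin.ofNat κ k.val : Fin κ) : ℕ) : ZMod (2 * n)) :=
  eq_sub_of_add_eq' (natCast_ofNat_add_mul_div k)

end Residues

/-! ### The graph on the cyclic group with two infinity elements -/

section PyramidGraph

variable {n : ℕ}

theorem inl_inr_notMem_lastFactor (x : ZMod (2 * n)) (j : Fin 2) :
    s(Sum.inl x, Sum.inr j) ∉ lastFactor n := by
  rintro (h | ⟨i, h⟩)
  · simp [infOne, infTwo] at h
  · simp at h

theorem inl_inl_mem_lastFactor_iff {x y : ZMod (2 * n)} :
    s(Sum.inl x, Sum.inl y) ∈ lastFactor n ↔ y = x + n := by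
  have h2 : (n : ZMod (2 * n)) + n = 0 := by
    rw [← two_mul]
    exact_mod_cast ZMod.natCast_self (2 * n)
  constructor
  · rintro (h | ⟨i, h⟩)
    · simp [infOne, infTwo] at h
    · simp only [Sym2.eq_iff, Sum.inl.injEq] at h
      rcases h with ⟨rfl, rfl⟩ | ⟨rfl, rfl⟩
      · rfl
      · rw [add_assoc, h2, add_zero]
  · rintro rfl
    exact Or.inr ⟨x, rfl⟩

theorem inl_inr_mem_pyrGraph (x : ZMod (2 * n)) (j : Fin 2) :
    s(Sum.inl x, Sum.inr j) ∈ (pyrGraph n).edgeSet := by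
  rw [pyrGraph, SimpleGraph.edgeSet_deleteEdges]
  exact ⟨by simp, inl_inr_notMem_lastFactor x j⟩

theorem inl_inl_mem_pyrGraph {x y : ZMod (2 * n)} (h : x ≠ y) (h' : y ≠ x + n) :
    s(Sum.inl x, Sum.inl y) ∈ (pyrGraph n).edgeSet := by
  rw [pyrGraph, SimpleGraph.edgeSet_deleteEdges]
  exact ⟨by simpa using h, fun hm => h' (inl_inl_mem_lastFactor_iff.1 hm)⟩

end PyramidGraph

/-! ### The induced factors, indexed by the neighbour of the first infinity element -/

section Starter

variable {n κ : ℕ} [NeZero κ]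

/-- The factor of the induced family that joins `k` to `∞₁`. -/
def starterFactor (S : Fin κ → Set (Sym2 (ZMod (2 * n)))) (k : ZMod (2 * n)) :
    Set (Sym2 (PyrVertex n)) :=
  Sym2.map (translateVertex ((κ * (k.val / κ) : ℕ) : ZMod (2 * n))) ''
    expandedStarter S (Fin.ofNat κ k.val)

variable (S : Fin κ → Set (Sym2 (ZMod (2 * n))))

theorem inducedFactorization_eq_range [NeZero n] (hκ : κ ∣ 2 * n) :
    inducedFactorization S = Set.range (starterFactor S) := by
  have hκ0 : 0 < κ := Nat.pos_of_neZero κ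
  ext F
  constructor
  · rintro ⟨i, τ, hτ, rfl⟩
    have hlt : (i : ℕ) + κ * τ < 2 * n := by
      have h1 : κ * (τ + 1) ≤ κ * (2 * n / κ) := Nat.mul_le_mul_left _ hτ
      rw [Nat.mul_div_cancel' hκ, mul_add, mul_one] at h1
      have := i.2
      omega
    refine ⟨((i + κ * τ : ℕ) : ZMod (2 * n)), ?_⟩
    rw [starterFactor, ofNat_val_natCast hκ, ZMod.val_natCast_of_lt hlt,
      Nat.add_mul_div_left _ _ hκ0, Nat.div_eq_of_lt i.2, zero_add]
    congr
    apply Fin.ext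
    rw [Fin.val_ofNat, Nat.add_mul_mod_self_left, Nat.mod_eq_of_lt i.2]
  · rintro ⟨k, rfl⟩
    exact ⟨_, _, Nat.div_lt_div_of_lt_of_dvd hκ (ZMod.val_lt k), rfl⟩

variable {S}

theorem starterColumns_natCast (hκ : κ ∣ 2 * n) (i : Fin κ) (hn : (i : ℕ) < 2 * n) :
    starterColumns S ((i : ℕ) : ZMod (2 * n)) = S i := by
  rw [starterColumns, ofNat_val_natCast hκ, ZMod.val_natCast_of_lt hn, Nat.div_eq_of_lt i.2,
    mul_zero, Nat.cast_zero, translatePairs_zero]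
  congr
  exact Fin.ext (Nat.mod_eq_of_lt i.2)

variable [NeZero n]

/-- Describes the factor of $k = i + \kappa\tau$ without reference to $i$ and $\tau$: translation
carries the element missing from $S_i$ to the one missing from the column of $k$. -/
theorem mem_starterFactor_iff {k : ZMod (2 * n)} {e : Sym2 (PyrVertex n)} :
    e ∈ starterFactor S k ↔ (∃ f ∈ starterColumns S k, e = Sym2.map Sum.inl f) ∨
      e = s(Sum.inl k, infOne n) ∨
      ∃ r, (r ≠ k ∧ ∀ f ∈ starterColumns S k, r ∉ f) ∧ e = s(Sum.inl r, infTwo n) := by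
  have hk := natCast_ofNat_add_mul_div (κ := κ) k
  rw [starterFactor, expandedStarter, Set.image_union, Set.image_union]
  simp only [starterColumns]
  set c : ZMod (2 * n) := ((κ * (k.val / κ) : ℕ) : ZMod (2 * n))
  set i := Fin.ofNat κ k.val
  rw [Set.mem_union, Set.mem_union, or_assoc]
  refine or_congr ?_ (or_congr ?_ ?_)
  · constructor
    · rintro ⟨_, ⟨f, hf, rfl⟩, rfl⟩
      refine ⟨_, ⟨f, hf, rfl⟩, ?_⟩
      rw [Sym2.map_map, Sym2.map_map]
      rfl
    · rintro ⟨_, ⟨f, hf, rfl⟩, rfl⟩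
      refine ⟨_, ⟨f, hf, rfl⟩, ?_⟩
      rw [Sym2.map_map, Sym2.map_map]
      rfl
  · rw [Set.image_singleton, Set.mem_singleton_iff, Sym2.map_mk]
    change _ = s(Sum.inl (c + ((i : ℕ) : ZMod (2 * n))), infOne n) ↔ _
    rw [add_comm, hk]
  · constructor
    · rintro ⟨_, ⟨r, hr, rfl⟩, rfl⟩
      refine ⟨c + r, ⟨?_, ?_⟩, rfl⟩
      · rw [← hk, add_comm c]
        exact fun h => hr.1 (add_right_cancel h)
      · rw [forall_translatePairs_notMem, add_sub_cancel_left]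
        exact hr.2
    · rintro ⟨r, hr, rfl⟩
      refine ⟨_, ⟨r - c, ⟨?_, forall_translatePairs_notMem.1 hr.2⟩, rfl⟩, ?_⟩
      · exact fun h => hr.1 (by rw [← hk, ← h, sub_add_cancel])
      · change s(Sum.inl (c + (r - c)), infTwo n) = _
        rw [add_sub_cancel]

theorem inl_inl_mem_starterFactor {k x y : ZMod (2 * n)} :
    s(Sum.inl x, Sum.inl y) ∈ starterFactor S k ↔ s(x, y) ∈ starterColumns S k := by
  rw [mem_starterFactor_iff]
  constructor
  · rintro (⟨f, hf, h⟩ | h | ⟨r, -, h⟩)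
    · rw [← Sym2.map_mk] at h
      rwa [Sym2.map.injective Sum.inl_injective h]
    · simp [infOne] at h
    · simp [infTwo] at h
  · exact fun h => Or.inl ⟨_, h, rfl⟩

theorem inl_infOne_mem_starterFactor {k x : ZMod (2 * n)} :
    s(Sum.inl x, infOne n) ∈ starterFactor S k ↔ x = k := by
  rw [mem_starterFactor_iff]
  constructor
  · rintro (⟨f, hf, h⟩ | h | ⟨r, -, h⟩)
    · induction f with | _ a b
      simp [infOne] at h
    · simpa [infOne] using h
    · simp [infOne, infTwo] at h
  · rintro rfl
    exact Or.inr (Or.inl rfl)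

theorem inl_infTwo_mem_starterFactor {k x : ZMod (2 * n)} :
    s(Sum.inl x, infTwo n) ∈ starterFactor S k ↔ x ≠ k ∧ ∀ f ∈ starterColumns S k, x ∉ f := by
  rw [mem_starterFactor_iff]
  constructor
  · rintro (⟨f, hf, h⟩ | h | ⟨r, hr, h⟩)
    · induction f with | _ a b
      simp [infTwo] at h
    · simp [infOne, infTwo] at h
    · have : x = r := by simpa [infTwo] using h
      rwa [this]
  · exact fun h => Or.inr (Or.inr ⟨x, h, rfl⟩)

theorem starterFactor_injective : Function.Injective (starterFactor S) := by
  intro k m h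
  exact inl_infOne_mem_starterFactor.1 (h ▸ inl_infOne_mem_starterFactor.2 rfl)

theorem lastFactor_notMem_inducedFactorization (hκ : κ ∣ 2 * n) :
    lastFactor n ∉ inducedFactorization S := by
  rw [inducedFactorization_eq_range S hκ]
  rintro ⟨k, hk⟩
  exact inl_inr_notMem_lastFactor k 0 (hk ▸ inl_infOne_mem_starterFactor.2 rfl)

theorem isOneFactor_starterFactor (hκ : κ ∣ 2 * n)
    (h : IsOneFactorization (pyrGraph n) (inducedFactorization S)) (k : ZMod (2 * n)) :
    IsOneFactor (starterFactor S k) :=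
  h.1 _ (by rw [inducedFactorization_eq_range S hκ]; exact ⟨k, rfl⟩)

theorem existsUnique_starterFactor (hκ : κ ∣ 2 * n)
    (h : IsOneFactorization (pyrGraph n) (inducedFactorization S)) {e : Sym2 (PyrVertex n)}
    (he : e ∈ (pyrGraph n).edgeSet) : ∃! k, e ∈ starterFactor S k := by
  obtain ⟨F, ⟨hF, heF⟩, hu⟩ := h.2.2 e he
  rw [inducedFactorization_eq_range S hκ] at hF hu
  obtain ⟨k, rfl⟩ := hF
  exact ⟨k, heF, fun m hm => starterFactor_injective (hu _ ⟨⟨m, rfl⟩, hm⟩)⟩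

end Starter

theorem natCast_fin_lt {n κ : ℕ} [NeZero n] (hκ : κ ∣ 2 * n) (i : Fin κ) : (i : ℕ) < 2 * n :=
  i.2.trans_le (Nat.le_of_dvd (Nat.pos_of_neZero _) hκ)

theorem image_lastFactor_swapInf (n : ℕ) : Sym2.map (swapInf n) '' lastFactor n = lastFactor n := by
  rw [lastFactor, Set.image_union, Set.image_singleton]
  congr 1
  · rw [Sym2.map_mk, Sym2.eq_swap]
    rfl
  · ext e
    constructor
    · rintro ⟨_, ⟨i, rfl⟩, rfl⟩
      exact ⟨i, rfl⟩
    · rintro ⟨i, rfl⟩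
      exact ⟨_, ⟨i, rfl⟩, rfl⟩

/-! ### Starter axioms and twins, from a one-factorization -/

section StarterOfFactorization

variable {n κ : ℕ} [NeZero κ] [NeZero n] {S T : Fin κ → Set (Sym2 (ZMod (2 * n)))}

theorem mk_mem_starterColumns_iff {k x y : ZMod (2 * n)} :
    s(x, y) ∈ starterColumns S k ↔
      s(x - (k - ((Fin.ofNat κ k.val : Fin κ) : ℕ)), y - (k - ((Fin.ofNat κ k.val : Fin κ) : ℕ))) ∈
        S (Fin.ofNat κ k.val) := by
  rw [starterColumns, mk_mem_translatePairs, natCast_mul_div]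

theorem starterColumns_eq (k : ZMod (2 * n)) : starterColumns S k =
    translatePairs (k - (((Fin.ofNat κ k.val : Fin κ) : ℕ) : ZMod (2 * n))) (S (Fin.ofNat κ k.val)) := by
  rw [starterColumns, natCast_mul_div]

theorem exists_infTwo_mem (hκ : κ ∣ 2 * n)
    (h : IsOneFactorization (pyrGraph n) (inducedFactorization S)) (k : ZMod (2 * n)) :
    ∃ r, s(Sum.inl r, infTwo n) ∈ starterFactor S k := by
  obtain ⟨r, hr⟩ := (isOneFactor_starterFactor hκ h k).exists_mem (infTwo n)
  rw [Sym2.eq_swap] at hr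
  rcases mem_starterFactor_iff.1 hr with ⟨f, -, hf⟩ | hf | ⟨x, -, hf⟩
  · induction f with | _ a b
    simp [infTwo] at hf
  · simp [infOne, infTwo] at hf
  · have : r = Sum.inl x := by simpa [infTwo] using hf
    exact ⟨x, this ▸ hr⟩

theorem ncard_starterColumns (hκ : κ ∣ 2 * n)
    (h : IsOneFactorization (pyrGraph n) (inducedFactorization S)) (k : ZMod (2 * n)) :
    (starterColumns S k).ncard = n - 1 := by
  have hF := isOneFactor_starterFactor hκ h k
  obtain ⟨r, hr⟩ := exists_infTwo_mem hκ h k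
  -- A factor on $2n+2$ vertices has $n+1$ edges; the two at the infinity elements are split off.
  have hdec : starterFactor S k = insert s(Sum.inl k, infOne n)
      (insert s(Sum.inl r, infTwo n) (Sym2.map Sum.inl '' starterColumns S k)) := by
    ext e
    rw [mem_starterFactor_iff]
    constructor
    · rintro (⟨f, hf, rfl⟩ | rfl | ⟨x, hx, rfl⟩)
      · exact Or.inr (Or.inr ⟨f, hf, rfl⟩)
      · exact Or.inl rfl
      · have := hF.mem_unique (Sym2.eq_swap ▸ hr)
          (Sym2.eq_swap ▸ inl_infTwo_mem_starterFactor.2 hx)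
        rw [this]
        exact Or.inr (Or.inl rfl)
    · rintro (rfl | rfl | ⟨f, hf, rfl⟩)
      · exact Or.inr (Or.inl rfl)
      · exact Or.inr (Or.inr ⟨r, inl_infTwo_mem_starterFactor.1 hr, rfl⟩)
      · exact Or.inl ⟨f, hf, rfl⟩
  have hcard := hF.two_mul_ncard
  rw [Fintype.card_sum, ZMod.card, Fintype.card_fin, hdec, Set.ncard_insert_of_notMem,
    Set.ncard_insert_of_notMem, Set.ncard_image_of_injective _
      (Sym2.map.injective Sum.inl_injective)] at hcard
  · omega
  · rintro ⟨f, -, hf⟩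
    induction f with | _ a b
    simp [infTwo] at hf
  · rintro (hf | ⟨f, -, hf⟩)
    · simp [infOne, infTwo] at hf
    · induction f with | _ a b
      simp [infOne] at hf

/-- Every edge $\{c+d, c\}$ lies in exactly one column. Modulo translation by multiples of $\kappa$
there is one such edge for each residue $c$ mod $\kappa$, and moving its column back to the starter
gives a bijection from these residues to the counted pairs. -/
theorem ncard_differences (hκ : κ ∣ 2 * n)
    (h : IsOneFactorization (pyrGraph n) (inducedFactorization S)) {d : ℕ} (hd : 1 ≤ d)
    (hdn : d ≤ n - 1) : {q : Fin κ × Sym2 (ZMod (2 * n)) |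
      q.2 ∈ S q.1 ∧ HasDifference (d : ZMod (2 * n)) q.2}.ncard = κ := by
  have hcast : ∀ m : ℕ, 0 < m → m < 2 * n → (m : ZMod (2 * n)) ≠ 0 := by
    intro m h0 hm h
    rw [ZMod.natCast_eq_zero_iff] at h
    exact absurd (Nat.le_of_dvd h0 h) (by omega)
  have hd0 := hcast d hd (by omega)
  have hdn' : (d : ZMod (2 * n)) ≠ n := by
    intro hdn'
    apply hcast (n - d) (by omega) (by omega)
    rw [Nat.cast_sub (by omega), hdn', sub_self]
  -- Since $2d \neq 0$, a pair has the difference $d$ in only one orientation, so its end $c$ is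
  -- well defined.
  have hdd : (d : ZMod (2 * n)) + d ≠ 0 := by
    rw [← Nat.cast_add]
    exact hcast _ (by omega) (by omega)
  have hex : ∀ c : ZMod (2 * n), ∃! k, s(c + d, c) ∈ starterColumns S k := by
    intro c
    simp_rw [← inl_inl_mem_starterFactor]
    rw [Sym2.eq_swap]
    exact existsUnique_starterFactor hκ h (inl_inl_mem_pyrGraph
      (fun h' => hd0 (by linear_combination - h')) (fun h' => hdn' (by linear_combination h')))
  choose K hK hKu using fun c : Fin κ => hex ((c : ℕ) : ZMod (2 * n))
  have hκn := natCast_fin_lt (n := n) hκ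
  have hres : ∀ (a b : Fin κ) (t : ZMod (2 * n)),
      ((a : ℕ) : ZMod (2 * n)) = (b : ℕ) + κ * t → a = b := by
    intro a b t hab
    have := ofNat_val_add_mul hκ ((b : ℕ) : ZMod (2 * n)) t
    rw [← hab, ofNat_val_natCast hκ, ofNat_val_natCast hκ] at this
    simpa [Fin.ofNat, Nat.mod_eq_of_lt, Fin.ext_iff] using this
  have hmul : ∀ k : ZMod (2 * n), ∃ t : ZMod (2 * n),
      k - ((Fin.ofNat κ k.val : Fin κ) : ℕ) = κ * t := fun k =>
    ⟨(k.val / κ : ℕ), by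
      rw [← natCast_mul_div]; push_cast; rfl⟩
  set sh : Fin κ → ZMod (2 * n) := fun c => K c - ((Fin.ofNat κ (K c).val : Fin κ) : ℕ) with hsh
  set G : Fin κ → Fin κ × Sym2 (ZMod (2 * n)) := fun c =>
    (Fin.ofNat κ (K c).val, s((c : ℕ) + d - sh c, (c : ℕ) - sh c)) with hG
  have hGinj : Function.Injective G := by
    intro c c' hcc
    obtain ⟨t, ht⟩ := hmul (K c)
    obtain ⟨t', ht'⟩ := hmul (K c')
    have h2 : s(((c : ℕ) : ZMod (2 * n)) + d - sh c, (c : ℕ) - sh c) =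
      s(((c' : ℕ) : ZMod (2 * n)) + d - sh c', (c' : ℕ) - sh c') := congrArg Prod.snd hcc
    rcases Sym2.eq_iff.1 h2 with ⟨-, h2⟩ | ⟨h2, h3⟩
    · apply hres c c' (t - t')
      linear_combination h2 + ht - ht'
    · exact absurd (by linear_combination h2 - h3) hdd
  have hrange : {q : Fin κ × Sym2 (ZMod (2 * n)) |
      q.2 ∈ S q.1 ∧ HasDifference (d : ZMod (2 * n)) q.2} = Set.range G := by
    ext q
    constructor
    · obtain ⟨i, e⟩ := q
      rintro ⟨he, x, y, rfl, hxy⟩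
      simp only at he
      set c := Fin.ofNat κ y.val with hc
      obtain ⟨t, ht⟩ := hmul y
      have hk : Fin.ofNat κ (((i : ℕ) : ZMod (2 * n)) + κ * -t).val = i := by
        rw [ofNat_val_add_mul hκ, ofNat_val_natCast hκ]
        exact Fin.ext (Nat.mod_eq_of_lt i.2)
      -- Translating $\{x, y\}$ by $-\kappa t$ moves $y$ to its residue $c$ and moves column $i$ to
      -- column $i - \kappa t$, which is then the unique column of $\{c+d, c\}$.
      have hKc : (i : ℕ) + (κ : ZMod (2 * n)) * -t = K c := by
        apply hKu c
        rw [mk_mem_starterColumns_iff, hk]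
        convert he using 2
        · linear_combination -hxy - ht
        · linear_combination -ht
      have hshc : sh c = -(κ * t) := by
        rw [hsh]
        simp only
        rw [← hKc, hk]
        ring
      refine ⟨c, Prod.ext ?_ ?_⟩
      · simp only [hG]
        rw [← hKc, hk]
      · simp only [hG]
        rw [hshc]
        congr 2
        · linear_combination -hxy - ht
        · linear_combination -ht
    · rintro ⟨c, rfl⟩
      exact ⟨mk_mem_starterColumns_iff.1 (hK c), _, _, rfl, by ring⟩
  rw [hrange, ← Nat.card_coe_set_eq, Nat.card_range_of_injective hGinj, Nat.card_fin]

/-- A family whose induced family is a one-factorization is an even multi-starter. -/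
theorem isEvenMultiStarter_of_isOneFactorization (hκ : κ ∣ 2 * n)
    (h : IsOneFactorization (pyrGraph n) (inducedFactorization S)) :
    IsEvenMultiStarter n κ S := by
  have hcol := fun i : Fin κ => starterColumns_natCast (S := S) hκ i (natCast_fin_lt hκ i)
  have hF := fun i : Fin κ => isOneFactor_starterFactor hκ h ((i : ℕ) : ZMod (2 * n))
  have hmem : ∀ (i : Fin κ), ∀ e ∈ S i, Sym2.map Sum.inl e ∈
      starterFactor S ((i : ℕ) : ZMod (2 * n)) := fun i e he =>
    mem_starterFactor_iff.2 (Or.inl ⟨e, (hcol i).symm ▸ he, rfl⟩)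
  refine ⟨hκ, fun i => ?_, fun i e he => ⟨?_, ?_⟩, fun i e he f hf x hxe hxf => ?_,
    fun d => ncard_differences hκ h⟩
  · rw [← hcol i, ncard_starterColumns hκ h]
  · intro hd
    apply (hF i).1 _ (hmem i e he)
    induction e with | _ x y
    simpa using hd
  · intro hi
    have := (hF i).edge_unique (hmem i e he) (inl_infOne_mem_starterFactor.2 rfl)
      (Sym2.mem_map.2 ⟨_, hi, rfl⟩) (Sym2.mem_mk_left _ _)
    induction e with | _ x y
    simp [infOne] at this
  · exact Sym2.map.injective Sum.inl_injective ((hF i).edge_unique (hmem i e he) (hmem i f hf)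
      (Sym2.mem_map.2 ⟨x, hxe, rfl⟩) (Sym2.mem_map.2 ⟨x, hxf, rfl⟩))

/-- The twin attaches to the neighbour $m$ of $\infty_2$ the column that $S$ attaches to the
neighbour $k$ of $\infty_1$. The shift in the definition of the twin is what makes this agree with
translation by multiples of $\kappa$. -/
theorem starterColumns_twin (hκ : κ ∣ 2 * n) (hT : IsTwinStarter n κ S T) {k m : ZMod (2 * n)}
    (hm : s(Sum.inl m, infTwo n) ∈ starterFactor S k) : starterColumns T m = starterColumns S k := by
  rw [inl_infTwo_mem_starterFactor, starterColumns_eq, forall_translatePairs_notMem] at hm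
  rw [starterColumns_eq, starterColumns_eq (S := S) k]
  set i := Fin.ofNat κ k.val
  set r : ZMod (2 * n) := m - (k - ((i : ℕ) : ZMod (2 * n))) with hr
  have htwin := hT.1 i r ⟨fun h => hm.1 (by linear_combination h + hr), hm.2⟩
  have hres : Fin.ofNat κ r.val = Fin.ofNat κ m.val := by
    rw [← ofNat_val_add_mul hκ m (-((k.val / κ : ℕ) : ZMod (2 * n))), hr, ← natCast_mul_div]
    congr 2
    push_cast
    ring
  rw [natCast_mul_div, hres] at htwin
  rw [htwin, translatePairs_translatePairs]
  congr 1
  linear_combination hr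

theorem image_starterFactor_swapInf (hκ : κ ∣ 2 * n) (hT : IsTwinStarter n κ S T)
    (h : IsOneFactorization (pyrGraph n) (inducedFactorization S)) {k m : ZMod (2 * n)}
    (hm : s(Sum.inl m, infTwo n) ∈ starterFactor S k) :
    Sym2.map (swapInf n) '' starterFactor S k = starterFactor T m := by
  have hF := isOneFactor_starterFactor hκ h k
  have hcol := starterColumns_twin hκ hT hm
  have hone : ∀ x : ZMod (2 * n), (swapInf n) (Sum.inl x) = Sum.inl x := fun _ => rfl
  have h12 : swapInf n (infOne n) = infTwo n := rfl
  have h21 : swapInf n (infTwo n) = infOne n := rfl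
  -- The column misses exactly $k$ and $m$; once $m$ takes the place of the index, $k$ becomes the
  -- missing element.
  have hmiss : ∀ r, (r ≠ m ∧ ∀ f ∈ starterColumns S k, r ∉ f) ↔ r = k := by
    intro r
    constructor
    · rintro ⟨hrm, hr⟩
      by_contra hrk
      exact hrm (Sum.inl_injective (hF.mem_unique (x := infTwo n)
        (Sym2.eq_swap ▸ inl_infTwo_mem_starterFactor.2 ⟨hrk, hr⟩) (Sym2.eq_swap ▸ hm)))
    · rintro rfl
      refine ⟨(inl_infTwo_mem_starterFactor.1 hm).1.symm, fun f hf hr => ?_⟩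
      obtain ⟨y, rfl⟩ := hr
      have := hF.mem_unique (inl_inl_mem_starterFactor.2 hf) (inl_infOne_mem_starterFactor.2 rfl)
      simp [infOne] at this
  have hmap : ∀ f : Sym2 (ZMod (2 * n)), Sym2.map (swapInf n) (Sym2.map Sum.inl f) =
      Sym2.map Sum.inl f := fun f => by
    rw [Sym2.map_map]
    rfl
  ext e
  rw [mem_starterFactor_iff, hcol]
  simp_rw [hmiss]
  constructor
  · rintro ⟨e, he, rfl⟩
    rcases mem_starterFactor_iff.1 he with ⟨f, hf, rfl⟩ | rfl | ⟨r, hr, rfl⟩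
    · exact Or.inl ⟨f, hf, hmap f⟩
    · exact Or.inr (Or.inr ⟨k, rfl, rfl⟩)
    · have : (Sum.inl r : PyrVertex n) = Sum.inl m := hF.mem_unique (x := infTwo n)
        (Sym2.eq_swap ▸ inl_infTwo_mem_starterFactor.2 hr) (Sym2.eq_swap ▸ hm)
      rw [this]
      exact Or.inr (Or.inl rfl)
  · rintro (⟨f, hf, rfl⟩ | rfl | ⟨r, rfl, rfl⟩)
    · exact ⟨_, mem_starterFactor_iff.2 (Or.inl ⟨f, hf, rfl⟩), hmap f⟩
    · exact ⟨_, hm, rfl⟩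
    · exact ⟨_, inl_infOne_mem_starterFactor.2 rfl, rfl⟩

/-- The twin induces the same family, with the infinity elements interchanged. -/
theorem inducedFactorization_twin (hκ : κ ∣ 2 * n) (hT : IsTwinStarter n κ S T)
    (h : IsOneFactorization (pyrGraph n) (inducedFactorization S)) :
    inducedFactorization T = relabel (swapInf n) (inducedFactorization S) := by
  rw [inducedFactorization_eq_range T hκ, inducedFactorization_eq_range S hκ]
  apply Set.Subset.antisymm
  · rintro _ ⟨m, rfl⟩
    obtain ⟨k, hk, -⟩ := existsUnique_starterFactor hκ h (inl_inr_mem_pyrGraph m 1)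
    exact ⟨_, ⟨k, rfl⟩, image_starterFactor_swapInf hκ hT h hk⟩
  · rintro _ ⟨_, ⟨k, rfl⟩, rfl⟩
    obtain ⟨m, hm⟩ := exists_infTwo_mem hκ h k
    exact ⟨m, (image_starterFactor_swapInf hκ hT h hm).symm⟩

theorem completedFactorization_twin (hκ : κ ∣ 2 * n) (hT : IsTwinStarter n κ S T)
    (h : IsOneFactorization (pyrGraph n) (inducedFactorization S)) :
    completedFactorization T = relabel (swapInf n) (completedFactorization S) := by
  rw [completedFactorization, completedFactorization, inducedFactorization_twin hκ hT h, relabel,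
    relabel, Set.image_insert_eq, image_lastFactor_swapInf]

end StarterOfFactorization

/-! ### Quasi-C-Codes from perfect one-factorizations -/

theorem elementalCyclic_pow_mul_apply {N : ℕ} [NeZero N] {β : Type*} (m : ℕ)
    (A : Matrix (ZMod N) β (ZMod 2)) (i : ZMod N) (j : β) :
    (elementalCyclic N ^ m * A) i j = A (i - m) j := by
  induction m generalizing i with
  | zero => simp
  | succ m ih =>
    rw [pow_succ', Matrix.mul_assoc, Matrix.mul_apply, Finset.sum_eq_single (i - 1)]
    · rw [ih, elementalCyclic, Matrix.of_apply, if_pos (by ring), one_mul]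
      congr 1
      push_cast
      ring
    · intro b _ hb
      rw [elementalCyclic, Matrix.of_apply, if_neg, zero_mul]
      intro h
      exact hb (by rw [h]; ring)
    · exact fun h => absurd (Finset.mem_univ _) h

/-- The matrix is square up to a bijection between rows and columns, so a trivial left kernel makes
it invertible. The left kernel consists of weights on the vertices, which suits the graph argument.
-/
theorem mulVec_bijective_of_vecMul {m k K : Type*} [Fintype m] [Fintype k] [DecidableEq m]
    [DecidableEq k] [Field K] (e : k ≃ m) (A : Matrix m k K)
    (h : ∀ w : m → K, Matrix.vecMul w A = 0 → w = 0) : Function.Bijective fun v => A.mulVec v := by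
  have hU : IsUnit (A.submatrix id e.symm) := by
    rw [← Matrix.vecMul_injective_iff_isUnit]
    refine (injective_iff_map_eq_zero (Matrix.vecMulLinear (A.submatrix id e.symm))).2 ?_
    intro w hw
    apply h
    ext j
    have := congrFun hw (e j)
    simpa [Matrix.vecMul, dotProduct] using this
  have key : (fun v => A.mulVec v) =
      (fun v => (A.submatrix id e.symm).mulVec v) ∘ fun v : k → K => v ∘ e.symm := by
    ext v i
    simp only [Function.comp_apply, Matrix.mulVec, dotProduct, Matrix.submatrix_apply, id]
    exact (e.symm.sum_comp (fun x => A i x * v x)).symm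
  rw [key]
  have hB : Function.Bijective (A.submatrix id e.symm).mulVec :=
    ⟨Matrix.mulVec_injective_iff_isUnit.2 hU, Matrix.mulVec_surjective_iff_isUnit.2 hU⟩
  exact hB.comp (e.symm.arrowCongr (Equiv.refl K)).symm.bijective

theorem sum_mul_mem_eq_zero {α : Type*} [Fintype α] [DecidableEq α] {x y : α} (hxy : x ≠ y)
    {w : α → ZMod 2} (h : ∑ i, w i * (if i ∈ s(x, y) then 1 else 0) = 0) : w x = w y := by
  have : ∑ i, w i * (if i ∈ s(x, y) then 1 else 0) = w x + w y := by
    rw [← Finset.sum_pair hxy, ← Finset.sum_subset (Finset.subset_univ {x, y})]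
    · refine Finset.sum_congr rfl fun i hi => ?_
      rw [if_pos (by simpa using hi), mul_one]
    · intro i _ hi
      rw [if_neg (by simpa using hi), mul_zero]
  exact CharTwo.add_eq_zero.1 (this.symm.trans h)

theorem sum_mul_single {α : Type*} [Fintype α] [DecidableEq α] {x : α}
    {w : α → ZMod 2} (h : ∑ i, w i * (if i = x then 1 else 0) = 0) : w x = 0 := by
  simpa using h

section Code

variable {n : ℕ}

/-- The parity-check blocks whose information bits are the edges `e k j`. -/
def edgeBlocks (e : ZMod (2 * n) → Fin n → Sym2 (ZMod (2 * n))) (k : ZMod (2 * n)) :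
    Matrix (ZMod (2 * n)) (Fin n) (ZMod 2) :=
  Matrix.of fun i j => if (j : ℕ) + 1 < n then (if i ∈ e k j then 1 else 0)
    else if i = k then 1 else 0

theorem edgeBlocks_of_lt {e : ZMod (2 * n) → Fin n → Sym2 (ZMod (2 * n))} {k i : ZMod (2 * n)}
    {j : Fin n} (hj : (j : ℕ) + 1 < n) : edgeBlocks e k i j = if i ∈ e k j then 1 else 0 :=
  if_pos hj

theorem edgeBlocks_of_not_lt {e : ZMod (2 * n) → Fin n → Sym2 (ZMod (2 * n))} {k i : ZMod (2 * n)}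
    {j : Fin n} (hj : ¬ (j : ℕ) + 1 < n) : edgeBlocks e k i j = if i = k then 1 else 0 :=
  if_neg hj

variable {κ : ℕ} [NeZero κ] [NeZero n] {S : Fin κ → Set (Sym2 (ZMod (2 * n)))}

/-- A weight vanishing at `m` and `k` and constant on the edges of two columns vanishes. -/
theorem eq_zero_of_constant_on_columns (hκ : κ ∣ 2 * n)
    (h : IsPerfectOneFactorization (pyrGraph n) (inducedFactorization S)) {m k : ZMod (2 * n)}
    (hmk : m ≠ k) {w : ZMod (2 * n) → ZMod 2} (hwm : w m = 0) (hwk : w k = 0)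
    (hm : ∀ x y, s(x, y) ∈ starterColumns S m → w x = w y)
    (hk : ∀ x y, s(x, y) ∈ starterColumns S k → w x = w y) : w = 0 := by
  obtain ⟨r, hr⟩ := exists_infTwo_mem hκ h.1 m
  obtain ⟨t, ht⟩ := exists_infTwo_mem hκ h.1 k
  -- The weight is extended by $0$ at $\infty_1$, matching its value at $m$ and $k$, and by a value
  -- at $\infty_2$ that each factor prescribes through its neighbour of $\infty_2$.
  set W : ZMod 2 → PyrVertex n → ZMod 2 := fun a => Sum.elim w ![0, a] with hW
  have hconst : ∀ (l r : ZMod (2 * n)), s(Sum.inl r, infTwo n) ∈ starterFactor S l → w l = 0 →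
      (∀ x y, s(x, y) ∈ starterColumns S l → w x = w y) →
      ∀ x y, s(x, y) ∈ starterFactor S l → W (w r) x = W (w r) y := by
    intro l r hr hwl hl x y hxy
    have hF := isOneFactor_starterFactor hκ h.1 l
    have hone : ∀ z, s(Sum.inl z, infOne n) ∈ starterFactor S l → w z = 0 := fun z hz => by
      rwa [inl_infOne_mem_starterFactor.1 hz]
    have htwo : ∀ z, s(Sum.inl z, infTwo n) ∈ starterFactor S l → w z = w r := fun z hz => by
      have : (Sum.inl z : PyrVertex n) = Sum.inl r := hF.mem_unique (x := infTwo n)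
        (Sym2.eq_swap ▸ hz) (Sym2.eq_swap ▸ hr)
      rw [Sum.inl_injective this]
    have hinf : ∀ a b : Fin 2, s((Sum.inr a : PyrVertex n), Sum.inr b) ∉ starterFactor S l := by
      intro a b hab
      rcases mem_starterFactor_iff.1 hab with ⟨f, -, hf⟩ | hf | ⟨x, -, hf⟩
      · induction f with | _ a b
        simp at hf
      · simp at hf
      · simp at hf
    have hmix : ∀ (z : ZMod (2 * n)) (a : Fin 2), s(Sum.inl z, Sum.inr a) ∈ starterFactor S l →
        w z = ![0, w r] a := by
      intro z a hz
      fin_cases a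
      · exact hone z hz
      · exact htwo z hz
    rcases x with x | a <;> rcases y with y | b
    · exact hl x y (inl_inl_mem_starterFactor.1 hxy)
    · exact hmix x b hxy
    · exact (hmix y a (Sym2.eq_swap ▸ hxy)).symm
    · exact absurd hxy (hinf a b)
  have cm := hconst m r hr hwm hm
  have ck := hconst k t ht hwk hk
  have sm := (isOneFactor_starterFactor hκ h.1 m).sum_eq_zero _ cm
  have sk := (isOneFactor_starterFactor hκ h.1 k).sum_eq_zero _ ck
  -- Both extensions have total sum zero and differ at most at $\infty_2$, so they agree. One and
  -- the same weight is thus constant along the union of the two factors.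
  have hrt : w r = w t := by
    simp only [hW, Fintype.sum_sum_type, Sum.elim_inl, Sum.elim_inr, Fin.sum_univ_two,
      Matrix.cons_val_zero, Matrix.cons_val_one] at sm sk
    exact add_left_cancel (add_left_cancel (sm.trans sk.symm))
  rw [← hrt] at ck
  have hspan := (h.2 (starterFactor S m) (by rw [inducedFactorization_eq_range S hκ]; exact ⟨m, rfl⟩)
    (starterFactor S k) (by rw [inducedFactorization_eq_range S hκ]; exact ⟨k, rfl⟩)
    (starterFactor_injective.ne hmk)).isSpanningEdgeSet
  ext x
  exact hspan (fun v => W (w r) v = 0)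
    (fun a b hab ha => by rwa [← hab.elim (cm a b) (ck a b)]) (infOne n) (Sum.inl x) rfl

/-- The columns constructed from a starter that induces a perfect one-factorization are those of a
quasi-C-Code. -/
theorem isQuasiCCode_starterColumns (hn : 2 ≤ n) (hκ : κ ∣ 2 * n)
    (h : IsPerfectOneFactorization (pyrGraph n) (inducedFactorization S)) :
    IsQuasiCCode n κ (starterColumns S) := by
  have hS := isEvenMultiStarter_of_isOneFactorization hκ h.1
  have hF := isOneFactor_starterFactor hκ h.1
  have henum : ∀ i, ∃ e : Fin n → Sym2 (ZMod (2 * n)),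
      Set.BijOn e {j : Fin n | (j : ℕ) + 1 < n} (S i) := by
    intro i
    refine (Set.toFinite _).exists_bijOn_of_encard_eq ?_
    rw [← Set.Finite.cast_ncard_eq (Set.toFinite _), ← Set.Finite.cast_ncard_eq (Set.toFinite _),
      hS.card i, Set.ncard_eq_toFinset_card']
    congr 1
    have : {j : Fin n | (j : ℕ) + 1 < n}.toFinset = Finset.univ.erase ⟨n - 1, by omega⟩ := by
      ext j
      simp [Fin.ext_iff]
      omega
    rw [this, Finset.card_erase_of_mem (Finset.mem_univ _), Finset.card_univ, Fintype.card_fin]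
  choose E hE using henum
  -- One enumeration per $S_i$ is fixed and then translated: the relation with powers of $E$
  -- compares ordered columns, so the order must agree throughout a translation class.
  set e : ZMod (2 * n) → Fin n → Sym2 (ZMod (2 * n)) := fun k j =>
    Sym2.map (fun x => ((κ * (k.val / κ) : ℕ) : ZMod (2 * n)) + x) (E (Fin.ofNat κ k.val) j) with he
  have hbij : ∀ k, Set.BijOn (e k) {j : Fin n | (j : ℕ) + 1 < n} (starterColumns S k) := fun k =>
    ((Sym2.map.injective (add_right_injective _)).injOn.bijOn_image).comp (hE _)
  have hmem : ∀ k (j : Fin n), (j : ℕ) + 1 < n → e k j ∈ starterColumns S k := fun k j hj =>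
    (hbij k).mapsTo hj
  have hsurj : ∀ k, ∀ f ∈ starterColumns S k, ∃ j : Fin n, (j : ℕ) + 1 < n ∧ e k j = f :=
    fun k f hf => (hbij k).surjOn hf
  have hcol : ∀ k, ∀ f ∈ starterColumns S k, ∀ f' ∈ starterColumns S k, ∀ x, x ∈ f → x ∈ f' →
      f = f' := fun k f hf f' hf' x hx hx' =>
    Sym2.map.injective Sum.inl_injective ((hF k).edge_unique
      (mem_starterFactor_iff.2 (Or.inl ⟨f, hf, rfl⟩)) (mem_starterFactor_iff.2 (Or.inl ⟨f', hf', rfl⟩))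
      (Sym2.mem_map.2 ⟨x, hx, rfl⟩) (Sym2.mem_map.2 ⟨x, hx', rfl⟩))
  have hdiag : ∀ k x y, s(x, y) ∈ starterColumns S k → x ≠ y := fun k x y hxy hne =>
    (hF k).ne (inl_inl_mem_starterFactor.2 hxy) (by rw [hne])
  have hnot : ∀ k, ∀ f ∈ starterColumns S k, k ∉ f := by
    rintro k f hf ⟨y, rfl⟩
    have := (hF k).mem_unique (inl_inl_mem_starterFactor.2 hf) (inl_infOne_mem_starterFactor.2 rfl)
    simp [infOne] at this
  have hlast : ((⟨n - 1, by omega⟩ : Fin n) : ℕ) + 1 = n := by simp only; omega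
  refine ⟨edgeBlocks e, ⟨hn, hκ, ?_, ?_, ?_, ?_⟩, ?_⟩
  · intro k j hj i
    exact edgeBlocks_of_not_lt (by omega)
  · intro i hi t ht
    have hlt : i + κ * t < 2 * n := by
      have h1 : κ * (t + 1) ≤ κ * (2 * n / κ) := Nat.mul_le_mul_left _ ht
      rw [Nat.mul_div_cancel' hκ, mul_add, mul_one] at h1
      omega
    have hi0 : i < 2 * n := by omega
    have hshift : ∀ j, e ((i + κ * t : ℕ) : ZMod (2 * n)) j =
        Sym2.map (fun x => ((κ * t : ℕ) : ZMod (2 * n)) + x) (e ((i : ℕ) : ZMod (2 * n)) j) := by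
      intro j
      simp only [he]
      rw [ofNat_val_natCast hκ, ofNat_val_natCast hκ, ZMod.val_natCast_of_lt hlt,
        ZMod.val_natCast_of_lt hi0, Nat.add_mul_div_left _ _ (Nat.pos_of_neZero κ),
        Nat.div_eq_of_lt hi, zero_add, mul_zero, Nat.cast_zero, Sym2.map_map]
      have : Fin.ofNat κ (i + κ * t) = Fin.ofNat κ i := Fin.ext (Nat.add_mul_mod_self_left _ _ _)
      rw [this]
      congr 1
      ext x
      simp
    ext a j
    rw [elementalCyclic_pow_mul_apply]
    by_cases hj : (j : ℕ) + 1 < n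
    · rw [edgeBlocks_of_lt hj, edgeBlocks_of_lt hj, hshift]
      congr 1
      rw [Sym2.mem_map, eq_iff_iff]
      constructor
      · rintro ⟨x, hx, rfl⟩
        simpa using hx
      · exact fun hx => ⟨_, hx, add_sub_cancel _ _⟩
    · rw [edgeBlocks_of_not_lt hj, edgeBlocks_of_not_lt hj]
      congr 1
      rw [eq_iff_iff, sub_eq_iff_eq_add]
      push_cast
      rfl
  · intro i
    have hone : ∀ {P : Prop} [Decidable P], (if P then (1 : ZMod 2) else 0) = 1 ↔ P := by
      intro P _
      simp
    -- Row $i$ has exactly one entry $1$ in each block, from the edge at $i$ or from the parity bit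
    -- if $i = k$, except in the block $k_0$ whose factor joins $i$ to $\infty_2$. This gives the
    -- weight $2n - 1$.
    obtain ⟨k₀, hk₀, hk₀u⟩ := existsUnique_starterFactor hκ h.1 (inl_inr_mem_pyrGraph i 1)
    have hinj : Set.InjOn Prod.fst
        {q : ZMod (2 * n) × Fin n | edgeBlocks e q.1 i q.2 = 1} := by
      rintro ⟨k, j⟩ hq ⟨k', j'⟩ hq' (rfl : k = k')
      simp only [Set.mem_ofPred_eq] at hq hq'
      congr 1
      by_cases hj : (j : ℕ) + 1 < n <;> by_cases hj' : (j' : ℕ) + 1 < n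
      · rw [edgeBlocks_of_lt hj, hone] at hq
        rw [edgeBlocks_of_lt hj', hone] at hq'
        exact (hbij k).injOn hj hj' (hcol k _ (hmem k j hj) _ (hmem k j' hj') i hq hq')
      · rw [edgeBlocks_of_lt hj, hone] at hq
        rw [edgeBlocks_of_not_lt hj', hone] at hq'
        exact absurd (hq' ▸ hq) (hnot k _ (hmem k j hj))
      · rw [edgeBlocks_of_not_lt hj, hone] at hq
        rw [edgeBlocks_of_lt hj', hone] at hq'
        exact absurd (hq ▸ hq') (hnot k _ (hmem k j' hj'))
      · exact Fin.ext (by omega)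
    have himg : Prod.fst '' {q : ZMod (2 * n) × Fin n | edgeBlocks e q.1 i q.2 = 1} = {k₀}ᶜ := by
      ext k
      rw [Set.mem_compl_singleton_iff]
      constructor
      · rintro ⟨⟨k, j⟩, hq, rfl⟩ (rfl : k = k₀)
        simp only [Set.mem_ofPred_eq] at hq
        obtain ⟨h1, h2⟩ := inl_infTwo_mem_starterFactor.1 hk₀
        by_cases hj : (j : ℕ) + 1 < n
        · rw [edgeBlocks_of_lt hj, hone] at hq
          exact h2 _ (hmem k j hj) hq
        · rw [edgeBlocks_of_not_lt hj, hone] at hq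
          exact h1 hq
      · intro hk
        by_cases hik : i = k
        · refine ⟨(k, ⟨n - 1, by omega⟩), ?_, rfl⟩
          rw [Set.mem_ofPred_eq, edgeBlocks_of_not_lt (by rw [hlast]; omega), if_pos hik]
        · have : ¬ ∀ f ∈ starterColumns S k, i ∉ f := fun hf =>
            hk (hk₀u k (inl_infTwo_mem_starterFactor.2 ⟨hik, hf⟩))
          push Not at this
          obtain ⟨f, hf, hif⟩ := this
          obtain ⟨j, hj, rfl⟩ := hsurj k f hf
          refine ⟨(k, j), ?_, rfl⟩
          rw [Set.mem_ofPred_eq, edgeBlocks_of_lt hj, if_pos hif]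
    rw [← hinj.ncard_image, himg, Set.ncard_compl, Set.ncard_singleton,
      Nat.card_zmod]
  · intro m k hmk
    refine mulVec_bijective_of_vecMul
      (Fintype.equivOfCardEq (by rw [Fintype.card_sum, Fintype.card_fin, ZMod.card]; omega)) _ ?_
    intro w hw
    -- The parity column of a block forces $w_l = 0$; the column of an edge $\{x, y\}$ forces $w_x +
    -- w_y = 0$, that is $w_x = w_y$.
    have hent : ∀ l, (∀ j, ∑ i, w i * edgeBlocks e l i j = 0) → w l = 0 ∧
        ∀ x y, s(x, y) ∈ starterColumns S l → w x = w y := by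
      intro l hl
      constructor
      · have := hl ⟨n - 1, by omega⟩
        simp_rw [edgeBlocks_of_not_lt (e := e) (j := ⟨n - 1, by omega⟩)
          (by rw [hlast]; omega : ¬ _ < n)] at this
        exact sum_mul_single this
      · intro x y hxy
        obtain ⟨j, hj, hjf⟩ := hsurj l _ hxy
        have := hl j
        simp_rw [edgeBlocks_of_lt hj, hjf] at this
        exact sum_mul_mem_eq_zero (hdiag l x y hxy) this
    have hm := hent m fun j => congrFun hw (Sum.inl j)
    have hk := hent k fun j => congrFun hw (Sum.inr j)
    exact eq_zero_of_constant_on_columns hκ h hmk hm.1 hk.1 hm.2 hk.2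
  · refine fun k => ⟨e k, hbij k, ?_, fun j hj i => edgeBlocks_of_lt hj⟩
    intro f hf hd
    induction f with | _ x y
    exact hdiag k x y hf (by simpa using hd)

end Code

/-- To identify an expanded set with a known one-factor it suffices to compare finite edges and the
edge at $\infty_1$. As $\infty_1$ is already matched with $i$, the vertex $\infty_2$ is matched with
a finite element, which is the missing one. -/
theorem expandedStarter_eq {n κ : ℕ} {S : Fin κ → Set (Sym2 (ZMod (2 * n)))} {i : Fin κ}
    {F : Set (Sym2 (PyrVertex n))} (hF : IsOneFactor F)
    (h1 : s(Sum.inl ((i : ℕ) : ZMod (2 * n)), infOne n) ∈ F)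
    (hS : ∀ x y, s(x, y) ∈ S i ↔ s(Sum.inl x, Sum.inl y) ∈ F) :
    (∀ r, IsMissing S i r ↔ s(Sum.inl r, infTwo n) ∈ F) ∧ expandedStarter S i = F := by
  have hone : ∀ z, s(z, infOne n) ∈ F → z = Sum.inl ((i : ℕ) : ZMod (2 * n)) := fun z hz =>
    hF.mem_unique (x := infOne n) (Sym2.eq_swap ▸ hz) (Sym2.eq_swap ▸ h1)
  have hmiss : ∀ r, IsMissing S i r ↔ s(Sum.inl r, infTwo n) ∈ F := by
    intro r
    constructor
    · rintro ⟨hri, hr⟩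
      obtain ⟨z, hz⟩ := hF.exists_mem (Sum.inl r)
      rcases z with y | a
      · exact absurd (Sym2.mem_mk_left _ _) (hr _ ((hS r y).2 hz))
      · fin_cases a
        · exact absurd (Sum.inl_injective (hone _ hz)) hri
        · exact hz
    · intro hr
      refine ⟨?_, ?_⟩
      · rintro rfl
        simpa [infOne, infTwo] using hF.mem_unique h1 hr
      · rintro _ he ⟨y, rfl⟩
        simpa [infTwo] using hF.mem_unique ((hS r y).1 he) hr
  refine ⟨hmiss, Set.Subset.antisymm ?_ ?_⟩
  · rintro _ ((⟨e, he, rfl⟩ | rfl) | ⟨r, hr, rfl⟩)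
    · induction e with | _ x y
      exact (hS x y).1 he
    · exact h1
    · exact (hmiss r).1 hr
  · have key : ∀ x z, s(Sum.inl x, z) ∈ F → s(Sum.inl x, z) ∈ expandedStarter S i := by
      intro x z hz
      rcases z with y | a
      · exact Or.inl (Or.inl ⟨_, (hS x y).2 hz, rfl⟩)
      · fin_cases a
        · rw [Sum.inl_injective (hone _ hz)]
          exact Or.inl (Or.inr rfl)
        · exact Or.inr ⟨x, (hmiss x).2 hz, rfl⟩
    intro e he
    induction e with | _ u v
    rcases u with x | a
    · exact key x v he
    · rcases v with y | b
      · rw [Sym2.eq_swap] at he ⊢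
        exact key _ _ he
      · exfalso
        have hne := hF.ne he
        fin_cases a <;> fin_cases b
        · exact hne rfl
        · exact Sum.inr_ne_inl (hone (infTwo n) (Sym2.eq_swap ▸ he))
        · exact Sum.inr_ne_inl (hone (infTwo n) he)
        · exact hne rfl

/-! ### Discrete logarithms and the residues 2 log x + c -/

section Logarithm

variable {p : ℕ} [Fact p.Prime] {g : (ZMod p)ˣ}

theorem pow_dlog (hg : ∀ x : (ZMod p)ˣ, x ∈ Subgroup.zpowers g) (x : (ZMod p)ˣ) : g ^ dlog g x = x := by
  obtain ⟨m, hm⟩ := (mem_powers_iff_mem_zpowers (x := g) (y := x)).2 (hg x)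
  exact Nat.sInf_mem (s := {i : ℕ | g ^ i = x}) ⟨m, hm⟩

theorem orderOf_eq_pred (hg : ∀ x : (ZMod p)ˣ, x ∈ Subgroup.zpowers g) : orderOf g = p - 1 := by
  rw [orderOf_eq_card_of_forall_mem_zpowers hg, Nat.card_eq_fintype_card, ZMod.card_units]

theorem pow_eq_pow_iff_natCast (hg : ∀ x : (ZMod p)ˣ, x ∈ Subgroup.zpowers g) {a b : ℕ} : g ^ a = g ^ b ↔ (a : ZMod (p - 1)) = b := by
  rw [pow_eq_pow_iff_modEq, orderOf_eq_pred hg, ZMod.natCast_eq_natCast_iff]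

theorem dlog_lt (hg : ∀ x : (ZMod p)ˣ, x ∈ Subgroup.zpowers g) (x : (ZMod p)ˣ) : dlog g x < p - 1 := by
  have hpos : 0 < p - 1 := Nat.pos_of_neZero _
  refine lt_of_le_of_lt (Nat.sInf_le (m := dlog g x % (p - 1)) ?_) (Nat.mod_lt _ hpos)
  rw [Set.mem_ofPred_eq, ← orderOf_eq_pred hg, pow_mod_orderOf, pow_dlog hg]

/-- The residue `2 log x + c`. -/
noncomputable def logPoint (g : (ZMod p)ˣ) (c : ℕ) (x : (ZMod p)ˣ) : ZMod (2 * (p - 1)) :=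
  ((2 * dlog g x + c : ℕ) : ZMod (2 * (p - 1)))

/-- Any exponent may replace the least one: exponents agree mod $p-1$, so their doubles agree mod
$2(p-1)$. -/
theorem logPoint_eq (hg : ∀ x : (ZMod p)ˣ, x ∈ Subgroup.zpowers g) {x : (ZMod p)ˣ} {m : ℕ} (h : g ^ m = x) (c : ℕ) :
    logPoint g c x = ((2 * m + c : ℕ) : ZMod (2 * (p - 1))) := by
  rw [logPoint, ZMod.natCast_eq_natCast_iff]
  refine Nat.ModEq.add_right _ (Nat.ModEq.mul_left' 2 ?_)
  rw [← ZMod.natCast_eq_natCast_iff, ← pow_eq_pow_iff_natCast hg, pow_dlog hg, h]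

theorem logPoint_one (hg : ∀ x : (ZMod p)ˣ, x ∈ Subgroup.zpowers g) (c : ℕ) : logPoint g c 1 = (c : ZMod (2 * (p - 1))) := by
  rw [logPoint_eq hg (pow_zero g), mul_zero, zero_add]

theorem add_logPoint (hg : ∀ x : (ZMod p)ˣ, x ∈ Subgroup.zpowers g) (m c : ℕ) (x : (ZMod p)ˣ) :
    ((2 * m : ℕ) : ZMod (2 * (p - 1))) + logPoint g c x = logPoint g c (g ^ m * x) := by
  rw [logPoint_eq hg (x := g ^ m * x) (m := m + dlog g x) (by rw [pow_add, pow_dlog hg]), logPoint]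
  push_cast
  ring

theorem logPoint_val (hg : ∀ x : (ZMod p)ˣ, x ∈ Subgroup.zpowers g) {c : ℕ} (hc : c < 2) (x : (ZMod p)ˣ) :
    (logPoint g c x).val = 2 * dlog g x + c := by
  rw [logPoint, ZMod.val_natCast_of_lt]
  have := dlog_lt hg x
  omega

theorem logPoint_inj (hg : ∀ x : (ZMod p)ˣ, x ∈ Subgroup.zpowers g) {c d : ℕ} (hc : c < 2) (hd : d < 2) {x y : (ZMod p)ˣ}
    (h : logPoint g c x = logPoint g d y) : c = d ∧ x = y := by
  have := congrArg ZMod.val h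
  rw [logPoint_val hg hc, logPoint_val hg hd] at this
  refine ⟨by omega, ?_⟩
  rw [← pow_dlog hg x, ← pow_dlog hg y]
  congr 1
  omega

theorem exists_logPoint (hg : ∀ x : (ZMod p)ˣ, x ∈ Subgroup.zpowers g) (v : ZMod (2 * (p - 1))) :
    ∃ (a : ZMod 2) (x : (ZMod p)ˣ), logPoint g a.val x = v := by
  refine ⟨((v.val : ℕ) : ZMod 2), g ^ (v.val / 2), ?_⟩
  rw [logPoint_eq hg rfl, ZMod.val_natCast, Nat.div_add_mod, ZMod.natCast_rightInverse]

theorem doubleAdd_dlog (hg : ∀ x : (ZMod p)ˣ, x ∈ Subgroup.zpowers g) (c : ℕ) (x : (ZMod p)ˣ) :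
    doubleAdd (p - 1) c ((dlog g x : ℕ) : ZMod (p - 1)) = logPoint g c x := by
  rw [doubleAdd, ZMod.val_natCast_of_lt (dlog_lt hg x), logPoint]

theorem natCast_dlog_inj (hg : ∀ x : (ZMod p)ˣ, x ∈ Subgroup.zpowers g) {x y : (ZMod p)ˣ}
    (h : ((dlog g x : ℕ) : ZMod (p - 1)) = (dlog g y : ℕ)) : x = y := by
  rwa [← pow_eq_pow_iff_natCast hg, pow_dlog hg, pow_dlog hg] at h

theorem exists_natCast_dlog (hg : ∀ x : (ZMod p)ˣ, x ∈ Subgroup.zpowers g) (r : ZMod (p - 1)) : ∃ x, ((dlog g x : ℕ) : ZMod (p - 1)) = r := by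
  refine ⟨g ^ r.val, ?_⟩
  rw [← ZMod.natCast_rightInverse r, ← pow_eq_pow_iff_natCast hg, pow_dlog hg,
    ZMod.natCast_rightInverse]

/-- Turns the translation by $n = p - 1 = 2 \cdot (p-1)/2$ into multiplication by $-1$. The power
squares to $1$ and is not $1$, because its exponent is positive and below the order of $g$. -/
theorem pow_half (hg : ∀ x : (ZMod p)ˣ, x ∈ Subgroup.zpowers g) (hp : p ≠ 2) : g ^ ((p - 1) / 2) = -1 := by
  have hodd := (Fact.out : p.Prime).odd_of_ne_two hp
  have h2 : 2 ≤ p := (Fact.out : p.Prime).two_le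
  have heven : (p - 1) / 2 * 2 = p - 1 := by
    obtain ⟨k, hk⟩ := hodd
    omega
  have hsq : (g ^ ((p - 1) / 2)) ^ 2 = 1 := by
    rw [← pow_mul, heven, ← orderOf_eq_pred hg, pow_orderOf_eq_one]
  have hne : g ^ ((p - 1) / 2) ≠ 1 := by
    refine pow_ne_one_of_lt_orderOf ?_ ?_
    · omega
    · rw [orderOf_eq_pred hg]
      omega
  have hsq' : ((g ^ ((p - 1) / 2) : (ZMod p)ˣ) : ZMod p) * (g ^ ((p - 1) / 2) : (ZMod p)ˣ) = 1 := by
    rw [← Units.val_mul, ← sq, hsq, Units.val_one]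
  exact Units.ext ((mul_self_eq_one_iff.1 hsq').resolve_left (fun h => hne (Units.ext h)))

end Logarithm

/-! ### Logarithmic coordinates for the explicit starter -/

section Coordinates

variable {p : ℕ} [hF : Fact p.Prime] {g : (ZMod p)ˣ}

/-- Coordinates on the vertices: `(a, x)` is `2 log x + a`, and `(0, 0)`, `(1, 0)` are `∞₂`, `∞₁`. -/
noncomputable def vertexOf (g : (ZMod p)ˣ) (v : ZMod 2 × ZMod p) : PyrVertex (p - 1) :=
  open Classical in
  if h : v.2 = 0 then (if v.1 = 0 then infTwo (p - 1) else infOne (p - 1))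
  else Sum.inl (logPoint g v.1.val (Units.mk0 v.2 h))

theorem vertexOf_zero_zero : vertexOf g (0, 0) = infTwo (p - 1) := by
  rw [vertexOf, dif_pos rfl, if_pos rfl]

theorem vertexOf_one_zero : vertexOf g (1, 0) = infOne (p - 1) := by
  rw [vertexOf, dif_pos rfl, if_neg one_ne_zero]

theorem vertexOf_unit (a : ZMod 2) (x : (ZMod p)ˣ) :
    vertexOf g (a, (x : ZMod p)) = Sum.inl (logPoint g a.val x) := by
  rw [vertexOf, dif_neg x.ne_zero, Units.mk0_val]

theorem card_pyrVertex : Nat.card (PyrVertex (p - 1)) = 2 * p := by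
  have := hF.out.two_le
  rw [Nat.card_eq_fintype_card, Fintype.card_sum, ZMod.card, Fintype.card_fin]
  omega

theorem vertex_cases (v : ZMod 2 × ZMod p) :
    v = (0, 0) ∨ v = (1, 0) ∨ ∃ (a : ZMod 2) (x : (ZMod p)ˣ), v = (a, (x : ZMod p)) := by
  obtain ⟨a, x⟩ := v
  by_cases h : x = 0
  · subst h
    rcases ZMod.two_cases a with rfl | rfl
    · exact Or.inl rfl
    · exact Or.inr (Or.inl rfl)
  · exact Or.inr (Or.inr ⟨a, Units.mk0 x h, rfl⟩)

theorem vertexOf_bijective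
    (hg : ∀ x : (ZMod p)ˣ, x ∈ Subgroup.zpowers g) :
    Function.Bijective (vertexOf g) := by
  have hsurj : Function.Surjective (vertexOf g) := by
    rintro (v | a)
    · obtain ⟨a, x, rfl⟩ := exists_logPoint hg v
      exact ⟨_, vertexOf_unit a x⟩
    · fin_cases a
      · exact ⟨_, vertexOf_one_zero⟩
      · exact ⟨_, vertexOf_zero_zero⟩
  refine hsurj.bijective_of_nat_card_le ?_
  rw [card_pyrVertex, Nat.card_prod, Nat.card_zmod, Nat.card_zmod]

/-- The coordinates as an equivalence. -/
noncomputable def vertexEquiv (hg : ∀ x : (ZMod p)ˣ, x ∈ Subgroup.zpowers g) :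
    ZMod 2 × ZMod p ≃ PyrVertex (p - 1) :=
  Equiv.ofBijective (vertexOf g) (vertexOf_bijective hg)

theorem vertexEquiv_zero_zero
    (hg : ∀ x : (ZMod p)ˣ, x ∈ Subgroup.zpowers g) : vertexEquiv hg (0, 0) = infTwo (p - 1) := vertexOf_zero_zero

theorem vertexEquiv_one_zero
    (hg : ∀ x : (ZMod p)ˣ, x ∈ Subgroup.zpowers g) : vertexEquiv hg (1, 0) = infOne (p - 1) := vertexOf_one_zero

theorem vertexEquiv_unit
    (hg : ∀ x : (ZMod p)ˣ, x ∈ Subgroup.zpowers g) (a : ZMod 2) (x : (ZMod p)ˣ) :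
    vertexEquiv hg (a, (x : ZMod p)) = Sum.inl (logPoint g a.val x) := vertexOf_unit a x

theorem vertexEquiv_zero_unit
    (hg : ∀ x : (ZMod p)ˣ, x ∈ Subgroup.zpowers g) (x : (ZMod p)ˣ) :
    vertexEquiv hg (0, (x : ZMod p)) = Sum.inl (logPoint g 0 x) := vertexOf_unit 0 x

theorem vertexEquiv_one_unit
    (hg : ∀ x : (ZMod p)ˣ, x ∈ Subgroup.zpowers g) (x : (ZMod p)ˣ) :
    vertexEquiv hg (1, (x : ZMod p)) = Sum.inl (logPoint g 1 x) := vertexOf_unit 1 x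

theorem mem_image_vertexEquiv
    (hg : ∀ x : (ZMod p)ˣ, x ∈ Subgroup.zpowers g) {F : Set (Sym2 (ZMod 2 × ZMod p))} (u v : ZMod 2 × ZMod p) :
    s(vertexEquiv hg u, vertexEquiv hg v) ∈ Sym2.map (vertexEquiv hg) '' F ↔ s(u, v) ∈ F := by
  rw [mem_map_image_iff, Equiv.symm_apply_apply, Equiv.symm_apply_apply]

/-- Multiplication of the second coordinate by a unit. -/
def scaleSecond (u : (ZMod p)ˣ) (v : ZMod 2 × ZMod p) : ZMod 2 × ZMod p := (v.1, u * v.2)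

/-- The logarithm turns the product with $g^m$ into a translation by $2m$; both infinity elements
have second coordinate $0$ and stay fixed. -/
theorem translateVertex_vertexEquiv
    (hg : ∀ x : (ZMod p)ˣ, x ∈ Subgroup.zpowers g) (m : ℕ) (v : ZMod 2 × ZMod p) :
    translateVertex ((2 * m : ℕ) : ZMod (2 * (p - 1))) (vertexEquiv hg v) =
      vertexEquiv hg (scaleSecond (g ^ m) v) := by
  rcases vertex_cases v with rfl | rfl | ⟨a, x, rfl⟩
  · rw [scaleSecond, mul_zero, vertexEquiv_zero_zero]
    rfl
  · rw [scaleSecond, mul_zero, vertexEquiv_one_zero]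
    rfl
  · rw [scaleSecond, ← Units.val_mul, vertexEquiv_unit, vertexEquiv_unit, ← add_logPoint hg]
    rfl

theorem image_involutionFactor {V W : Type*} {σ : V → V} {τ : W → W} {f : V → W}
    (hf : Function.Surjective f) (h : ∀ v, f (σ v) = τ (f v)) :
    Sym2.map f '' involutionFactor σ = involutionFactor τ := by
  apply eq_involutionFactor
  · rintro _ ⟨_, ⟨v, rfl⟩, rfl⟩
    exact ⟨f v, by rw [Sym2.map_mk, h]⟩
  · intro w
    obtain ⟨v, rfl⟩ := hf w
    exact ⟨_, ⟨v, rfl⟩, by rw [Sym2.map_mk, h]⟩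

theorem scaleSecond_surjective (u : (ZMod p)ˣ) : Function.Surjective (scaleSecond u) := by
  rintro ⟨a, x⟩
  exact ⟨(a, (u⁻¹ : (ZMod p)ˣ) * x), Prod.ext rfl (u.mul_inv_cancel_left x)⟩

theorem scaleSecond_layerShift (u : (ZMod p)ˣ) (v : ZMod 2 × ZMod p) :
    scaleSecond u (layerShift 1 v) = layerShift (u : ZMod p) (scaleSecond u v) := by
  obtain ⟨a, x⟩ := v
  rcases ZMod.two_cases a with rfl | rfl
  · simp only [scaleSecond, layerShift_zero, mul_sub, mul_one]
  · simp only [scaleSecond, layerShift_one, mul_add, mul_one]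

theorem scaleSecond_layerReflection (u : (ZMod p)ˣ) (v : ZMod 2 × ZMod p) :
    scaleSecond u (layerReflection 1 v) = layerReflection (u : ZMod p) (scaleSecond u v) := by
  obtain ⟨a, x⟩ := v
  by_cases h : 2 * x = 1
  · have h' : 2 * ((u : ZMod p) * x) = u := by linear_combination u * h
    simp only [scaleSecond, layerReflection_of_eq h, layerReflection_of_eq h']
  · have h' : 2 * ((u : ZMod p) * x) ≠ u := fun h' =>
      h (u.isUnit.mul_left_cancel (by linear_combination h'))
    simp only [scaleSecond, layerReflection_of_ne h, layerReflection_of_ne h', mul_sub, mul_one]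

theorem image_translateVertex
    (hg : ∀ x : (ZMod p)ˣ, x ∈ Subgroup.zpowers g) (m : ℕ) (F : Set (Sym2 (ZMod 2 × ZMod p))) :
    Sym2.map (translateVertex ((2 * m : ℕ) : ZMod (2 * (p - 1)))) ''
      (Sym2.map (vertexEquiv hg) '' F) =
      Sym2.map (vertexEquiv hg) '' (Sym2.map (scaleSecond (g ^ m)) '' F) := by
  rw [Set.image_image, Set.image_image]
  refine Set.image_congr fun e _ => ?_
  rw [Sym2.map_map, Sym2.map_map]
  congr 1
  ext v
  exact translateVertex_vertexEquiv hg m v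

/-- Reflection at $0$ is negation, that is adding $p-1$ in $Z_{2(p-1)}$, and the two copies of its
fixed point $0$ are $\infty_1$ and $\infty_2$. -/
theorem image_lastFactor
    (hg : ∀ x : (ZMod p)ˣ, x ∈ Subgroup.zpowers g) (hp : p ≠ 2) :
    lastFactor (p - 1) = Sym2.map (vertexEquiv hg) '' involutionFactor (layerReflection 0) := by
  have h2 : (2 : ZMod p) ≠ 0 := Ring.two_ne_zero (by rwa [ZMod.ringChar_zmod_n])
  have hneg : ∀ (c : ℕ) (x : (ZMod p)ˣ),
      logPoint g c x + ((p - 1 : ℕ) : ZMod (2 * (p - 1))) = logPoint g c (-x) := by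
    intro c x
    rw [← neg_one_mul, ← pow_half hg hp, ← add_logPoint hg, add_comm]
    congr 2
    obtain ⟨k, hk⟩ := hF.out.odd_of_ne_two hp
    omega
  have hmem : ∀ (a : ZMod 2) (x : (ZMod p)ˣ),
      layerReflection 0 (a, (x : ZMod p)) = (a, ((-x : (ZMod p)ˣ) : ZMod p)) := fun a x => by
    rw [layerReflection_of_ne (mul_ne_zero h2 x.ne_zero), zero_sub, Units.val_neg]
  apply Set.Subset.antisymm
  · rintro _ (rfl | ⟨i, rfl⟩)
    · refine ⟨_, ⟨(1, 0), rfl⟩, ?_⟩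
      rw [layerReflection_of_eq (mul_zero _), Sym2.map_mk, vertexEquiv_one_zero]
      exact congrArg _ (vertexEquiv_zero_zero hg)
    · obtain ⟨a, x, rfl⟩ := exists_logPoint hg i
      refine ⟨_, ⟨(a, (x : ZMod p)), rfl⟩, ?_⟩
      rw [hmem, Sym2.map_mk, vertexEquiv_unit, vertexEquiv_unit, hneg]
  · rintro _ ⟨_, ⟨v, rfl⟩, rfl⟩
    rcases vertex_cases v with rfl | rfl | ⟨a, x, rfl⟩
    · left
      rw [layerReflection_of_eq (mul_zero _), zero_add, Sym2.map_mk, vertexEquiv_one_zero,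
        vertexEquiv_zero_zero, Sym2.eq_swap]
      rfl
    · left
      rw [layerReflection_of_eq (mul_zero _), Sym2.map_mk, vertexEquiv_one_zero]
      exact congrArg _ (vertexEquiv_zero_zero hg)
    · right
      refine ⟨logPoint g a.val x, ?_⟩
      rw [hmem, Sym2.map_mk, vertexEquiv_unit, vertexEquiv_unit, hneg]

theorem isOneFactor_image_layerShift
    (hg : ∀ x : (ZMod p)ˣ, x ∈ Subgroup.zpowers g) (c : ZMod p) :
    IsOneFactor (Sym2.map (vertexEquiv hg) '' involutionFactor (layerShift c)) :=
  (isOneFactor_involutionFactor (layerShift_involutive c) (layerShift_ne c)).image _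

theorem isOneFactor_image_layerReflection
    (hg : ∀ x : (ZMod p)ˣ, x ∈ Subgroup.zpowers g) (c : ZMod p) :
    IsOneFactor (Sym2.map (vertexEquiv hg) '' involutionFactor (layerReflection c)) :=
  (isOneFactor_involutionFactor (layerReflection_involutive c) (layerReflection_ne c)).image _

theorem mem_starterZero_iff
    (hg : ∀ x : (ZMod p)ˣ, x ∈ Subgroup.zpowers g) (x y : ZMod (2 * (p - 1))) : s(x, y) ∈ starterZero p g ↔
    s(Sum.inl x, Sum.inl y) ∈
      Sym2.map (vertexEquiv hg) '' involutionFactor (layerShift 1) := by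
  constructor
  · rintro ⟨a, b, -, -, hab, h⟩
    rw [← Sym2.map_mk, h]
    exact ⟨_, mem_layerShift_zero_one.2 hab, by
      rw [Sym2.map_mk, vertexEquiv_zero_unit, vertexEquiv_one_unit]; rfl⟩
  · have key : ∀ (a b : (ZMod p)ˣ), (a : ZMod p) - b = 1 →
        s(logPoint g 0 a, logPoint g 1 b) ∈ starterZero p g := by
      -- The exclusions $x \neq 1$, $y \neq -1$ are automatic for units: they only rule out $y = 0$
      -- and $x = 0$, the edges at the infinity elements.
      refine fun a b hab => ⟨a, b, ?_, ?_, hab, rfl⟩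
      · exact fun h => b.ne_zero (by linear_combination h - hab)
      · exact fun h => a.ne_zero (by linear_combination h + hab)
    obtain ⟨a, u, rfl⟩ := exists_logPoint hg x
    obtain ⟨b, v, rfl⟩ := exists_logPoint hg y
    rw [← vertexEquiv_unit hg, ← vertexEquiv_unit hg, mem_image_vertexEquiv]
    intro h
    rcases ZMod.two_cases a with rfl | rfl <;> rcases ZMod.two_cases b with rfl | rfl
    · exact absurd h mem_layerShift_same
    · exact key u v (mem_layerShift_zero_one.1 h)
    · rw [Sym2.eq_swap] at h ⊢
      exact key v u (mem_layerShift_zero_one.1 h)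
    · exact absurd h mem_layerShift_same

theorem mem_starterOne_iff
    (hg : ∀ x : (ZMod p)ˣ, x ∈ Subgroup.zpowers g) (hp : p ≠ 2) (x y : ZMod (2 * (p - 1))) : s(x, y) ∈ starterOne p g ↔
    s(Sum.inl x, Sum.inl y) ∈
      Sym2.map (vertexEquiv hg) '' involutionFactor (layerReflection 1) := by
  have h2 : (2 : ZMod p) ≠ 0 := Ring.two_ne_zero (by rwa [ZMod.ringChar_zmod_n])
  have hhalf : ∀ z : ZMod p, 2 * z = 1 ↔ z = 2⁻¹ := fun z =>
    ⟨fun h => eq_inv_of_mul_eq_one_right h, fun h => by rw [h, mul_inv_cancel₀ h2]⟩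
  constructor
  · have key : ∀ a : ZMod 2, s(x, y) ∈ Sym2.map (doubleAdd (p - 1) a.val) '' pairsA p g →
        s(Sum.inl x, Sum.inl y) ∈
          Sym2.map (vertexEquiv hg) '' involutionFactor (layerReflection 1) := by
      rintro a ⟨_, ⟨u, v, -, hu, -, hv, huv, rfl⟩, h⟩
      rw [Sym2.map_mk, doubleAdd_dlog hg, doubleAdd_dlog hg] at h
      rw [← Sym2.map_mk, ← h, Sym2.map_mk, ← vertexEquiv_unit hg, ← vertexEquiv_unit hg,
        mem_image_vertexEquiv, mem_layerReflection_same]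
      · exact huv
      · intro h
        apply hu
        rw [← hhalf]
        linear_combination huv + h
    rintro ((h | h) | ⟨r, hr, hrA, h⟩)
    · exact key 1 h
    · exact key 0 h
    · obtain ⟨u, rfl⟩ := exists_natCast_dlog hg r
      rw [doubleAdd_dlog hg, doubleAdd_dlog hg] at h
      rw [← Sym2.map_mk, h, Sym2.map_mk, ← vertexEquiv_zero_unit hg, ← vertexEquiv_one_unit hg,
        mem_image_vertexEquiv, mem_layerReflection_zero_one, and_iff_right rfl, hhalf]
      -- The element $r$ is $\log_g 2^{-1}$: any unit $u$ other than $1$ and $2^{-1}$ occurs in the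
      -- pair of $u$ and $1-u$, and $r \neq 0$ excludes $u = 1$.
      by_contra hu
      have hu1 : (u : ZMod p) ≠ 1 := by
        intro h1
        apply hr
        rw [show u = 1 from Units.ext h1, ← Nat.cast_zero, ← pow_eq_pow_iff_natCast hg,
          pow_dlog hg, pow_zero]
      have hv0 : 1 - (u : ZMod p) ≠ 0 := sub_ne_zero.2 hu1.symm
      refine hrA _ ⟨u, Units.mk0 _ hv0, hu1, hu, ?_, ?_, ?_, rfl⟩ (Sym2.mem_mk_left _ _)
      · exact fun h => u.ne_zero (by rw [Units.val_mk0] at h; linear_combination -h)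
      · intro h
        rw [Units.val_mk0, ← hhalf] at h
        exact hu ((hhalf _).1 (by linear_combination -h))
      · rw [Units.val_mk0, add_sub_cancel]
  · have mixed : ∀ u v : (ZMod p)ˣ, s(((0 : ZMod 2), (u : ZMod p)), ((1 : ZMod 2), (v : ZMod p))) ∈
        involutionFactor (layerReflection 1) →
        s(logPoint g 0 u, logPoint g 1 v) ∈ starterOne p g := by
      intro u v h
      rw [mem_layerReflection_zero_one] at h
      obtain ⟨huv, hu⟩ := h
      obtain rfl := Units.ext huv
      refine Or.inr ⟨((dlog g u : ℕ) : ZMod (p - 1)), ?_, ?_, ?_⟩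
      · intro h
        rw [← Nat.cast_zero, ← pow_eq_pow_iff_natCast hg, pow_dlog hg, pow_zero] at h
        rw [h, Units.val_one] at hu
        exact one_ne_zero (by linear_combination hu : (1 : ZMod p) = 0)
      · rintro _ ⟨x, y, -, hx, -, hy, -, rfl⟩ hf
        rw [hhalf] at hu
        rcases Sym2.mem_iff.1 hf with hf | hf
        · exact hx (by rw [← natCast_dlog_inj hg hf, hu])
        · exact hy (by rw [← natCast_dlog_inj hg hf, hu])
      · rw [doubleAdd_dlog hg, doubleAdd_dlog hg]
    have same : ∀ (a : ZMod 2) (u v : (ZMod p)ˣ), s((a, (u : ZMod p)), (a, (v : ZMod p))) ∈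
        involutionFactor (layerReflection 1) → s(logPoint g a.val u, logPoint g a.val v) ∈
          Sym2.map (doubleAdd (p - 1) a.val) '' pairsA p g := by
      intro a u v h
      have huv : (u : ZMod p) ≠ v := fun huv =>
        (isOneFactor_involutionFactor (layerReflection_involutive 1) (layerReflection_ne 1)).ne h
          (by rw [huv])
      rw [mem_layerReflection_same huv] at h
      refine ⟨_, ⟨u, v, ?_, ?_, ?_, ?_, h, rfl⟩, ?_⟩
      · exact fun h1 => v.ne_zero (by linear_combination h - h1)
      · rw [ne_eq, ← hhalf]
        exact fun h1 => huv (by linear_combination h1 - h)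
      · exact fun h1 => u.ne_zero (by linear_combination h - h1)
      · rw [ne_eq, ← hhalf]
        exact fun h1 => huv (by linear_combination h - h1)
      · rw [Sym2.map_mk, doubleAdd_dlog hg, doubleAdd_dlog hg]
    obtain ⟨a, u, rfl⟩ := exists_logPoint hg x
    obtain ⟨b, v, rfl⟩ := exists_logPoint hg y
    rw [← vertexEquiv_unit hg, ← vertexEquiv_unit hg, mem_image_vertexEquiv]
    intro h
    rcases ZMod.two_cases a with rfl | rfl <;> rcases ZMod.two_cases b with rfl | rfl
    · exact Or.inl (Or.inr (same 0 u v h))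
    · exact mixed u v h
    · rw [Sym2.eq_swap] at h ⊢
      exact mixed v u h
    · exact Or.inl (Or.inl (same 1 u v h))

theorem expandedStarter_starterS_zero
    (hg : ∀ x : (ZMod p)ˣ, x ∈ Subgroup.zpowers g) :
    (∀ r, IsMissing (starterS p g) 0 r ↔ s(Sum.inl r, infTwo (p - 1)) ∈
      Sym2.map (vertexEquiv hg) '' involutionFactor (layerShift 1)) ∧
    expandedStarter (starterS p g) 0 =
      Sym2.map (vertexEquiv hg) '' involutionFactor (layerShift 1) := by
  refine expandedStarter_eq (isOneFactor_image_layerShift hg 1) ?_ (mem_starterZero_iff hg)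
  have : (Sum.inl (((0 : Fin 2) : ℕ) : ZMod (2 * (p - 1))) : PyrVertex (p - 1)) =
      vertexEquiv hg (0, ((1 : (ZMod p)ˣ) : ZMod p)) := by
    rw [vertexEquiv_zero_unit, logPoint_one hg]
    rfl
  rw [this, ← vertexEquiv_one_zero hg, mem_image_vertexEquiv, mem_layerShift_zero_one]
  simp

theorem expandedStarter_starterS_one
    (hg : ∀ x : (ZMod p)ˣ, x ∈ Subgroup.zpowers g) (hp : p ≠ 2) :
    (∀ r, IsMissing (starterS p g) 1 r ↔ s(Sum.inl r, infTwo (p - 1)) ∈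
      Sym2.map (vertexEquiv hg) '' involutionFactor (layerReflection 1)) ∧
    expandedStarter (starterS p g) 1 =
      Sym2.map (vertexEquiv hg) '' involutionFactor (layerReflection 1) := by
  refine expandedStarter_eq (isOneFactor_image_layerReflection hg 1) ?_ (mem_starterOne_iff hg hp)
  have : (Sum.inl (((1 : Fin 2) : ℕ) : ZMod (2 * (p - 1))) : PyrVertex (p - 1)) =
      vertexEquiv hg (1, ((1 : (ZMod p)ˣ) : ZMod p)) := by
    rw [vertexEquiv_one_unit, logPoint_one hg]
    rfl
  rw [this, ← vertexEquiv_one_zero hg, mem_image_vertexEquiv, Units.val_one,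
    mem_layerReflection_same one_ne_zero, add_zero]

/-- Scaling by $g^m$ carries the shift and the reflection factor of $1$ to those of $g^m$, and $g$
generates all units. Only the reflection factor of $0$ is left over, and this is the completing
factor. -/
theorem completedFactorization_starterS
    (hg : ∀ x : (ZMod p)ˣ, x ∈ Subgroup.zpowers g) (hp : p ≠ 2) :
    completedFactorization (starterS p g) = relabel (vertexEquiv hg) (layerFactors p) := by
  have h0 := (expandedStarter_starterS_zero hg).2
  have h1 := (expandedStarter_starterS_one hg hp).2
  have hzero : ∀ m, Sym2.map (translateVertex ((2 * m : ℕ) : ZMod (2 * (p - 1)))) ''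
      expandedStarter (starterS p g) 0 = Sym2.map (vertexEquiv hg) ''
        involutionFactor (layerShift ((g ^ m : (ZMod p)ˣ) : ZMod p)) := fun m => by
    rw [h0, image_translateVertex, image_involutionFactor (scaleSecond_surjective _)
      (scaleSecond_layerShift _)]
  have hone : ∀ m, Sym2.map (translateVertex ((2 * m : ℕ) : ZMod (2 * (p - 1)))) ''
      expandedStarter (starterS p g) 1 = Sym2.map (vertexEquiv hg) ''
        involutionFactor (layerReflection ((g ^ m : (ZMod p)ˣ) : ZMod p)) := fun m => by
    rw [h1, image_translateVertex, image_involutionFactor (scaleSecond_surjective _)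
      (scaleSecond_layerReflection _)]
  -- The admissible numbers of translations, $0 \le \tau < 2n/\kappa = p-1$, cover all values of the
  -- logarithm.
  have hlt : ∀ x, dlog g x < 2 * (p - 1) / 2 := fun x => by
    rw [Nat.mul_div_cancel_left _ two_pos]
    exact dlog_lt hg x
  apply Set.Subset.antisymm
  · rintro _ (rfl | ⟨i, m, -, rfl⟩)
    · exact ⟨_, Or.inl ⟨0, rfl⟩, (image_lastFactor hg hp).symm⟩
    · fin_cases i
      · exact ⟨_, Or.inr ⟨_, Units.ne_zero _, rfl⟩, (hzero m).symm⟩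
      · exact ⟨_, Or.inl ⟨_, rfl⟩, (hone m).symm⟩
  · rintro _ ⟨_, ⟨c, rfl⟩ | ⟨c, hc, rfl⟩, rfl⟩
    · by_cases hc : c = 0
      · subst hc
        exact Or.inl (image_lastFactor hg hp).symm
      · refine Or.inr ⟨1, dlog g (Units.mk0 c hc), hlt _, ?_⟩
        rw [hone, pow_dlog hg, Units.val_mk0]
    · refine Or.inr ⟨0, dlog g (Units.mk0 c hc), hlt _, ?_⟩
      rw [hzero, pow_dlog hg, Units.val_mk0]

/-- Translation by $-2\log_g(-1)$ is multiplication by $-1$, and $x - y = 1$ is the same as $(-y) -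
(-x) = 1$, so the two layers exchange roles. -/
theorem twinOne_eq
    (hg : ∀ x : (ZMod p)ˣ, x ∈ Subgroup.zpowers g) : twinOne p g =
    translatePairs (-((2 * dlog g (-1) : ℕ) : ZMod (2 * (p - 1)))) (starterZero p g) := by
  have hneg : ∀ c x, -((2 * dlog g (-1) : ℕ) : ZMod (2 * (p - 1))) + logPoint g c x =
      logPoint g c (-x) := fun c x => by
    rw [neg_add_eq_iff_eq_add, add_logPoint hg, pow_dlog hg, neg_one_mul, neg_neg]
  apply Set.Subset.antisymm
  · rintro _ ⟨x, y, hx, hy, hxy, rfl⟩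
    refine ⟨s(logPoint g 0 (-y), logPoint g 1 (-x)), ⟨-y, -x, ?_, ?_, ?_, rfl⟩, ?_⟩
    · exact fun h => hy (by rw [← h, Units.val_neg, neg_neg])
    · exact fun h => hx (by rw [Units.val_neg] at h; exact neg_injective h)
    · rw [Units.val_neg, Units.val_neg]
      linear_combination hxy
    · rw [Sym2.map_mk, hneg, hneg, neg_neg, neg_neg, Sym2.eq_swap]
      rfl
  · rintro _ ⟨_, ⟨x, y, hx, hy, hxy, rfl⟩, rfl⟩
    refine ⟨-y, -x, ?_, ?_, ?_, ?_⟩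
    · exact fun h => hy (by rw [← h, Units.val_neg, neg_neg])
    · exact fun h => hx (by rw [Units.val_neg] at h; exact neg_injective h)
    · rw [Units.val_neg, Units.val_neg]
      linear_combination hxy
    · change s(-((2 * dlog g (-1) : ℕ) : ZMod (2 * (p - 1))) + logPoint g 0 x,
        -((2 * dlog g (-1) : ℕ) : ZMod (2 * (p - 1))) + logPoint g 1 y) = _
      rw [hneg, hneg, Sym2.eq_swap]
      rfl

/-- The missing element is the neighbour of $\infty_2 = (0,0)$, here $(1,-1)$. It is odd, so $S_0$
gives the twin's set with index $1$. -/
theorem isMissing_starterS_zero_iff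
    (hg : ∀ x : (ZMod p)ˣ, x ∈ Subgroup.zpowers g) {r : ZMod (2 * (p - 1))} :
    IsMissing (starterS p g) 0 r ↔ r = logPoint g 1 (-1) := by
  rw [(expandedStarter_starterS_zero hg).1]
  obtain ⟨a, x, rfl⟩ := exists_logPoint hg r
  rw [← vertexEquiv_unit hg, ← vertexEquiv_zero_zero hg, mem_image_vertexEquiv]
  rcases ZMod.two_cases a with rfl | rfl
  · exact iff_of_false mem_layerShift_same
      (fun h => absurd (logPoint_inj hg two_pos one_lt_two h).1 zero_ne_one)
  · rw [Sym2.eq_swap, mem_layerShift_zero_one, zero_sub, neg_eq_iff_eq_neg]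
    constructor
    · intro h
      rw [show x = -1 from Units.ext h]
      rfl
    · intro h
      rw [(logPoint_inj hg one_lt_two one_lt_two h).2, Units.val_neg, Units.val_one]

/-- Reflection at $1$ sends $(0,0)$ to $(0,1)$, which is the residue $0$; hence $S_1$ becomes $S'_0$
without translation. -/
theorem isMissing_starterS_one_iff
    (hg : ∀ x : (ZMod p)ˣ, x ∈ Subgroup.zpowers g) (hp : p ≠ 2) {r : ZMod (2 * (p - 1))} :
    IsMissing (starterS p g) 1 r ↔ r = 0 := by
  have h0 : logPoint g 0 1 = 0 := by rw [logPoint_one hg, Nat.cast_zero]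
  rw [(expandedStarter_starterS_one hg hp).1, ← h0]
  obtain ⟨a, x, rfl⟩ := exists_logPoint hg r
  rw [← vertexEquiv_unit hg, ← vertexEquiv_zero_zero hg, mem_image_vertexEquiv]
  rcases ZMod.two_cases a with rfl | rfl
  · rw [mem_layerReflection_same x.ne_zero, add_zero]
    constructor
    · intro h
      rw [show x = 1 from Units.ext h]
      rfl
    · intro h
      rw [(logPoint_inj hg two_pos two_pos h).2, Units.val_one]
  · rw [Sym2.eq_swap, mem_layerReflection_zero_one]
    exact iff_of_false (fun h => x.ne_zero h.1.symm)
      (fun h => absurd (logPoint_inj hg one_lt_two two_pos h).1 one_ne_zero)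

theorem isTwinStarter_starterS
    (hg : ∀ x : (ZMod p)ˣ, x ∈ Subgroup.zpowers g) (hp : p ≠ 2) :
    IsTwinStarter (p - 1) 2 (starterS p g) (twinS p g) := by
  have hval := logPoint_val hg one_lt_two (-1)
  have hmod : Fin.ofNat 2 (logPoint g 1 (-1)).val = 1 := by
    apply Fin.ext
    change (logPoint g 1 (-1)).val % 2 = 1
    rw [hval]
    omega
  refine ⟨fun i r hr => ?_, fun j => ?_⟩
  · fin_cases i
    · obtain rfl := (isMissing_starterS_zero_iff hg).1 hr
      rw [hmod, hval, show (2 * dlog g (-1) + 1) / 2 = dlog g (-1) by omega]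
      exact twinOne_eq hg
    · obtain rfl := (isMissing_starterS_one_iff hg hp).1 hr
      rw [ZMod.val_zero, Nat.zero_div, mul_zero, Nat.cast_zero, neg_zero, translatePairs_zero]
      rfl
  · fin_cases j
    · refine ⟨1, 0, (isMissing_starterS_one_iff hg hp).2 rfl, ?_⟩
      rw [ZMod.val_zero]
      rfl
    · exact ⟨0, _, (isMissing_starterS_zero_iff hg).2 rfl, hmod⟩

/-- The columns with index $0$ are $S_0$ and $S_1$. The pair of $(0,2)$ and $(1,1)$ lies in $S_0$
because $2 - 1 = 1$, while pairs of $S_1$ between the layers have equal second coordinates. -/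
theorem starterColumns_ne
    (hg : ∀ x : (ZMod p)ˣ, x ∈ Subgroup.zpowers g) (hp : p ≠ 2) :
    starterColumns (starterS p g) ≠ starterColumns (twinS p g) := by
  have h2 : (2 : ZMod p) ≠ 0 := Ring.two_ne_zero (by rwa [ZMod.ringChar_zmod_n])
  intro h
  have h0 := congrFun h (((0 : Fin 2) : ℕ) : ZMod (2 * (p - 1)))
  have hlt := natCast_fin_lt (n := p - 1) (dvd_mul_right 2 (p - 1)) 0
  rw [starterColumns_natCast (dvd_mul_right _ _) 0 hlt,
    starterColumns_natCast (dvd_mul_right _ _) 0 hlt] at h0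
  change starterZero p g = starterOne p g at h0
  have hmem : s(logPoint g 0 (Units.mk0 2 h2), logPoint g 1 1) ∈ starterZero p g := by
    rw [mem_starterZero_iff hg, ← vertexEquiv_zero_unit hg, ← vertexEquiv_one_unit hg,
      mem_image_vertexEquiv, mem_layerShift_zero_one, Units.val_mk0, Units.val_one]
    ring
  rw [h0, mem_starterOne_iff hg hp, ← vertexEquiv_zero_unit hg, ← vertexEquiv_one_unit hg,
    mem_image_vertexEquiv, mem_layerReflection_zero_one, Units.val_mk0, Units.val_one] at hmem
  exact one_ne_zero (by linear_combination hmem.1 : (1 : ZMod p) = 0)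

end Coordinates

/-! ### Assembly of the starter, factorization and code statements -/

theorem mainTheorem6 (p : ℕ) [Fact p.Prime] (hp : p ≠ 2) (g : (ZMod p)ˣ)
    (hg : ∀ x : (ZMod p)ˣ, x ∈ Subgroup.zpowers g) :
    -- two even 2-starters in `Z_{2(p-1)}`, twins of each other
    IsEvenMultiStarter (p - 1) 2 (starterS p g) ∧
    IsEvenMultiStarter (p - 1) 2 (twinS p g) ∧
    IsTwinStarter (p - 1) 2 (starterS p g) (twinS p g) ∧
    -- both induce a perfect one-factorization of the `2(p-1)`-regular graph on `2p` vertices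
    IsPerfectOneFactorization (pyrGraph (p - 1)) (inducedFactorization (starterS p g)) ∧
    IsPerfectOneFactorization (pyrGraph (p - 1)) (inducedFactorization (twinS p g)) ∧
    -- the same one up to the names of the two infinity elements
    inducedFactorization (twinS p g) =
      relabel (swapInf (p - 1)) (inducedFactorization (starterS p g)) ∧
    -- completed, they are perfect one-factorizations of `K_{2p}`, isomorphic to `GA_{2p}`
    Nat.card (PyrVertex (p - 1)) = 2 * p ∧
    IsPerfectOneFactorization (⊤ : SimpleGraph (PyrVertex (p - 1)))
      (completedFactorization (starterS p g)) ∧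
    IsPerfectOneFactorization (⊤ : SimpleGraph (PyrVertex (p - 1)))
      (completedFactorization (twinS p g)) ∧
    OneFactorizationIso (completedFactorization (starterS p g)) (GA p) ∧
    OneFactorizationIso (completedFactorization (twinS p g)) (GA p) ∧
    -- two different 2-quasi-C-Codes of length `2(p-1)`
    IsQuasiCCode (p - 1) 2 (starterColumns (starterS p g)) ∧
    IsQuasiCCode (p - 1) 2 (starterColumns (twinS p g)) ∧
    starterColumns (starterS p g) ≠ starterColumns (twinS p g) := by
  have hn : 2 ≤ p - 1 := by
    obtain ⟨k, hk⟩ := (Fact.out : p.Prime).odd_of_ne_two hp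
    have := (Fact.out : p.Prime).two_le
    omega
  have hκ : 2 ∣ 2 * (p - 1) := dvd_mul_right _ _
  obtain ⟨ψ, hψ⟩ := relabel_GA hp
  have hcomp := completedFactorization_starterS hg hp
  have hP1 : IsPerfectOneFactorization (⊤ : SimpleGraph (PyrVertex (p - 1)))
      (completedFactorization (starterS p g)) := by
    rw [hcomp]
    exact (isPerfectOneFactorization_layerFactors hp).relabel_top _
  have hI1 : IsPerfectOneFactorization (pyrGraph (p - 1)) (inducedFactorization (starterS p g)) :=
    hP1.deleteEdges (lastFactor_notMem_inducedFactorization hκ)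
  have hT := isTwinStarter_starterS hg hp
  -- Interchanging $\infty_1$ and $\infty_2$ fixes the last factor, so the twin's completion is a
  -- relabelling and inherits perfectness and the isomorphism type.
  have hcompT := completedFactorization_twin hκ hT hI1.1
  have hP2 : IsPerfectOneFactorization (⊤ : SimpleGraph (PyrVertex (p - 1)))
      (completedFactorization (twinS p g)) := by
    rw [hcompT]
    exact hP1.relabel_top _
  have hI2 : IsPerfectOneFactorization (pyrGraph (p - 1)) (inducedFactorization (twinS p g)) :=
    hP2.deleteEdges (lastFactor_notMem_inducedFactorization hκ)
  have hback : relabel ψ.symm (layerFactors p) = GA p := by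
    rw [← hψ, relabel_trans, Equiv.self_trans_symm, relabel_refl]
  have hiso : relabel ((vertexEquiv hg).symm.trans ψ.symm)
      (completedFactorization (starterS p g)) = GA p := by
    rw [hcomp, relabel_trans, ← Equiv.trans_assoc, Equiv.self_trans_symm, Equiv.refl_trans, hback]
  refine ⟨isEvenMultiStarter_of_isOneFactorization hκ hI1.1,
    isEvenMultiStarter_of_isOneFactorization hκ hI2.1, hT, hI1, hI2,
    inducedFactorization_twin hκ hT hI1.1, card_pyrVertex, hP1, hP2, ⟨_, hiso⟩,
    ⟨(swapInf (p - 1)).symm.trans ((vertexEquiv hg).symm.trans ψ.symm), ?_⟩,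
    isQuasiCCode_starterColumns hn hκ hI1, isQuasiCCode_starterColumns hn hκ hI2,
    starterColumns_ne hg hp⟩
  rw [hcompT, relabel_trans, ← Equiv.trans_assoc, Equiv.self_trans_symm, Equiv.refl_trans, hiso]
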